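/- **Setting.** Let $\Gamma$ be a finite extensive-form game with perfect recall and players $1,\dots,n$ (no chance moves; at each decision node one or several players move, simultaneously if several), with information sets, pure strategy sets $\Sigma_j$, and real utilities $u_j$. Write $\Sigma_{-j}$ for the strategy profiles of the players other than $j$. *Conditional dominance.* For $\Sigma'=\Sigma'_1\times\cdots\times\Sigma'_n$, a strategy $\sigma\in\Sigma'_j$ is conditionally dominated on $\Sigma'$ if there are an information set $I$ of $j$ and a mixed strategy $\sigma'$ of $j$ such that the set $T$ of all $\tau_{-j}\in\Sigma'_{-j}$ for which $(\sigma,\tau_{-j})$ reaches $I$, and $(\sigma'',\tau_{-j})$ reaches $I$ for every $\sigma''$ in the support of $\sigma'$, is nonempty, and $u_j(\sigma',\tau_{-j})>u_j(\sigma,\tau_{-j})$ for all $\tau_{-j}\in T$. Let $\mathrm{NCD}^0_j=\Sigma_j$, and let $\mathrm{NCD}^{k+1}_j$ be the set of $\sigma\in\mathrm{NCD}^k_j$ that are not conditionally dominated on $\mathrm{NCD}^k_1\times\cdots\times\mathrm{NCD}^k_n$. (The extensive-form rationalizable strategies of $j$ are those in $\bigcap_k\mathrm{NCD}^k_j$.)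 *Structures.* A lexicographic probability sequence (LPS) is a finite nonempty sequence $\vec\mu=(\mu_0,\dots,\mu_r)$ of probability measures; $\vec\mu(A)=\vec 1$ means that all $\mu_h(A)=1$, and $\vec\mu(A)\neq\vec 0$ that some $\mu_h(A)>0$ (with inner measure if $A$ is not measurable); $\vec\mu\mid A$ is obtained by dropping the $\mu_h$ with $\mu_h(A)=0$ and conditioning the others on $A$. A structure is $M=(\Omega,\mathbf s,\mathcal F,PR_1,\dots,PR_n)$ with a set $\Omega$ of states, a pure strategy profile $\mathbf s(\omega)$ for each $\omega\in\Omega$, a $\sigma$-algebra $\mathcal F$ on $\Omega\times\mathbb N$, and an LPS $PR_j(\omega,m)$ on $(\Omega\times\mathbb N,\mathcal F)$ for each $\omega\in\Omega$, $m\in\mathbb N$. Let $\mathrm{node}(\omega,m)$ be the $m$-th node on the path of $\mathbf s(\omega)$ (node $0$ is the root; the final leaf is repeated forever). For an information set $I$, let $[I]=\{(\omega,m):\mathrm{node}(\omega,m)\in I\}$. $M$ is *appropriate* if, for all players $j$ and all $\omega,m$: 1. $\{(\omega',m'):\mathbf s_j(\omega')=\sigma_j\}\in\mathcal F$ for all $\sigma_j\in\Sigma_j$;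 2. $PR_j(\omega,m)(\{(\omega',m'):\mathbf s_j(\omega')=\mathbf s_j(\omega)\})=\vec1$; 3. $\{(\omega',m'):PR_j(\omega',m')=\vec\mu\}\in\mathcal F$ for every LPS $\vec\mu$; 4. $PR_j(\omega,m)(\{(\omega',m'):PR_j(\omega',m')=PR_j(\omega,m)\})=\vec1$; 5. if $\mathrm{node}(\omega,m)$ lies in an information set $I$ of $j$, then $PR_j(\omega,m)([I])=\vec1$; moreover $PR_j(\omega,0)(\Omega\times\{0\})=\vec1$; 6. for $\tau_{-j}\in\Sigma_{-j}$, if $PR_j(\omega,m+1)(\{\mathbf s_{-j}=\tau_{-j}\})\ne\vec0$ then $PR_j(\omega,m)(\{\mathbf s_{-j}=\tau_{-j}\})\neq\vec0$. $M$ *respects conditioning* if, for all $j$, $\omega$ and $m>0$: $PR_j(\omega,m)=PR_j(\omega,m-1)$ if $j$ does not move at $\mathrm{node}(\omega,m)$; and if $\mathrm{node}(\omega,m)$ lies in an information set $I$ of $j$, then $PR'_j(\omega,m)=PR'_j(\omega,m-1)\mid\{\omega':\mathbf s(\omega')\text{ reaches }I\}$ (the right side being defined), where $PR'_j$ is the projection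 of $PR_j$ onto $\Omega$. *Formulas* are evaluated at triples $(M,\omega,m)$; $true$, $\neg$ and $\land$ have the usual meaning. - $play_j(\sigma)$ holds iff $\mathbf s_j(\omega)=\sigma$. - $B_j\varphi$ (resp. $\langle B_j\rangle\varphi$) holds iff some $F\in\mathcal F$ contained in the set of $(\omega',m')$ at which $\varphi$ holds in $M$ satisfies $PR_j(\omega,m)(F)=\vec1$ (resp. $\ne\vec0$). - $RAT_j$ holds iff $j$ does not move at $\mathrm{node}(\omega,m)$, or this node lies in an information set $I$ of $j$ and $\mathbf s_j(\omega)$ is a best response, conditional on reaching $I$ and among the strategies of $j$ that agree with it at all information sets of $j$ preceding $I$, to the beliefs on $\Sigma_{-j}$ induced by the first measure of $PR_j(\omega,m)$. - $\Diamond\varphi$ holds iff $\varphi$ holds at some $(M',\omega',m')$ with $M'$ appropriate for $\Gamma$. - $\mathrm{init}(\varphi)$ holds iff $\varphi$ holds at $(M,\omega,0)$, and $G\varphi$ iff $\varphi$ holds at $(M,\omega,m')$ for all $m'\ge m$. - $O_j\varphi$ ("all $j$ knows is $\varphi$") is $B_j\varphi\land\bigwedge_{\psi}(\Diamond(\varphi\land\psi)\Rightarrow\langle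 B_j\rangle\psi)$, where $\psi$ ranges over the Boolean combinations of the formulas $play_l(\sigma)$ with $l\ne j$, $\sigma\in\Sigma_l$. Let $RATEFR^0_j$ be $true$, and let $RATEFR^{k+1}_j$ be $$\mathrm{init}(B_jG\,RAT_j)\;\land\bigwedge_{\sigma'\in\Sigma_j}\bigl(play_j(\sigma')\Rightarrow\Diamond(play_j(\sigma')\land RATEFR^k_j)\bigr)\;\land\;\mathrm{init}\Bigl(O_j\bigl(\textstyle\bigwedge_{l\ne j}RATEFR^k_l\bigr)\Bigr).$$ Let $\mathcal L^1$ be the language generated by $true$ and the $RAT_j$ under $\neg,\land,B_j,\langle B_j\rangle$; $M$ is $\mathcal L^1$-measurable if every formula of $\mathcal L^1$ defines a set in $\mathcal F$. **Theorem.** For every $k\ge0$, every player $i$ and every $\sigma\in\Sigma_i$, the following are equivalent: - (a) $\sigma\in\mathrm{NCD}^k_i$; - (b) there are an $\mathcal L^1$-measurable appropriate structure $M$ that respects conditioning, a state $\omega$ and a time $m$ such that $\mathbf s_i(\omega)=\sigma$ and $(M,\omega,m)\models RATEFR^k_i$; - (c) there are an appropriate structure $M$ that respects conditioning, a state $\omega$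 and a time $m$ such that $\mathbf s_i(\omega)=\sigma$ and $(M,\omega,m)\models RATEFR^k_i$; - (d) there are an $\mathcal L^1$-measurable appropriate structure $M$, a state $\omega$ and a time $m$ such that $\mathbf s_i(\omega)=\sigma$ and $(M,\omega,m)\models RATEFR^k_i$; - (e) there are an appropriate structure $M$, a state $\omega$ and a time $m$ such that $\mathbf s_i(\omega)=\sigma$ and $(M,\omega,m)\models RATEFR^k_i$. In addition, for every $k\ge0$ there is an appropriate structure $\bar M^k=(\Omega^k,\mathbf s,\mathcal F,PR_1,\dots,PR_n)$ that respects conditioning, with $\Omega^k=\{(k',i,\vec\sigma):0\le k'\le k,\ 1\le i\le n,\ \vec\sigma\in\mathrm{NCD}^{k'}_1\times\cdots\times\mathrm{NCD}^{k'}_n\}$ (a finite set), $\mathbf s(k',i,\vec\sigma)=\vec\sigma$ and $\mathcal F=2^{\Omega^k\times\mathbb N}$, such that $(\bar M^k,(k',i,\vec\sigma),m)\models\bigwedge_{j\ne i}RATEFR^{k'}_j$ for all $(k',i,\vec\sigma)\in\Omega^k$ and all $m\ge0$. -/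

import Mathlib

open MeasureTheory

/-! ### Finite games in extensive form -/

/-- A joint move at the decision node `d`: an action for every player who moves at `d`. Here
`info i d = some I` says that player `i` moves at `d` and that `d` lies in her information set `I`,
and `info i d = none` that she does not move at `d`. -/
abbrev JointMove {n : ℕ} {D : Type} {Info : Fin n → Type} (Act : ∀ i, Info i → Type)
    (info : ∀ i, D → Option (Info i)) (d : D) : Type :=
  ∀ (i : Fin n) (I : Info i), info i d = some I → Act i I

/-- A finite `n`-player game tree with information sets and payoffs at the leaves. The usual case is
that exactly one player moves at each decision node; several players may also move simultaneously,
so that games in normal form are included (one decision node, at which all players move). -/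
structure ExtGame (n : ℕ) where
  /-- decision nodes -/
  D : Type
  /-- leaves -/
  Z : Type
  /-- information sets of each player -/
  Info : Fin n → Type
  /-- actions available at each information set -/
  Act : ∀ i, Info i → Type
  finite_D : Finite D
  finite_Z : Finite Z
  finite_Info : ∀ i, Finite (Info i)
  finite_Act : ∀ i I, Finite (Act i I)
  nonempty_Act : ∀ i I, Nonempty (Act i I)
  /-- the information set of player `i` that contains a decision node, if `i` moves there -/
  info : ∀ i, D → Option (Info i)
  info_nonempty : ∀ i I, ∃ d, info i d = some I
  root : D ⊕ Z
  child : ∀ d, JointMove Act info d → D ⊕ Z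
  /-- different edges lead to different nodes -/
  child_injective : Function.Injective (fun p : Σ d, JointMove Act info d => child p.1 p.2)
  root_not_child : ∀ d a, child d a ≠ root
  /-- every node is reached from the root -/
  reachable : ∀ v, Relation.ReflTransGen (fun x y => ∃ d a, x = Sum.inl d ∧ child d a = y) root v
  /-- payoffs -/
  u : Fin n → Z → ℝ

namespace ExtGame

variable {n : ℕ} (Γ : ExtGame n)

instance (i : Fin n) : Finite (Γ.Info i) := Γ.finite_Info i
instance (i : Fin n) (I : Γ.Info i) : Finite (Γ.Act i I) := Γ.finite_Act i I
instance (i : Fin n) (I : Γ.Info i) : Nonempty (Γ.Act i I) := Γ.nonempty_Act i I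
instance : Finite Γ.D := Γ.finite_D
instance : Finite Γ.Z := Γ.finite_Z

abbrev Node : Type := Γ.D ⊕ Γ.Z

/-- `y` is at or below `x` in the tree. -/
def Below : Γ.Node → Γ.Node → Prop :=
  Relation.ReflTransGen (fun x y => ∃ d a, x = Sum.inl d ∧ Γ.child d a = y)

/-- The node `v` belongs to the information set `I` of player `i`. -/
def InInfo (i : Fin n) (I : Γ.Info i) (v : Γ.Node) : Prop :=
  ∃ d, v = Sum.inl d ∧ Γ.info i d = some I

/-- Player `i` moves at the node `v`. -/
def MovesAt (i : Fin n) (v : Γ.Node) : Prop := ∃ I, Γ.InInfo i I v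

/-- On the path from the root to `v`, player `i` takes the action `a` at a node of her information
set `I` that strictly precedes `v`. -/
def ChoicePrecedes (i : Fin n) (I : Γ.Info i) (a : Γ.Act i I) (v : Γ.Node) : Prop :=
  ∃ (d : Γ.D) (h : Γ.info i d = some I) (b : JointMove Γ.Act Γ.info d),
    b i I h = a ∧ Γ.Below (Γ.child d b) v

/-- Perfect recall: a choice of player `i` that precedes one node of an information set of `i`
precedes all nodes of this information set. -/
def PerfectRecall : Prop :=
  ∀ (i : Fin n) (I I' : Γ.Info i) (a : Γ.Act i I') (v w : Γ.Node),
    Γ.InInfo i I v → Γ.InInfo i I w → Γ.ChoicePrecedes i I' a v → Γ.ChoicePrecedes i I' a w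

/-- The information set `I'` of player `i` strictly precedes her information set `I`. -/
def InfoPrecedes (i : Fin n) (I' I : Γ.Info i) : Prop :=
  ∃ a v, Γ.InInfo i I v ∧ Γ.ChoicePrecedes i I' a v

/-- Pure strategies of player `i`. -/
abbrev Strat (i : Fin n) : Type := ∀ I : Γ.Info i, Γ.Act i I

/-- Pure strategy profiles. -/
abbrev Profile : Type := ∀ i, Γ.Strat i

noncomputable instance (i : Fin n) : Fintype (Γ.Strat i) := Fintype.ofFinite _

/-- The node that follows `v` under a strategy profile; leaves are kept fixed. -/
def step (s : Γ.Profile) : Γ.Node → Γ.Node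
  | Sum.inl d => Γ.child d (fun i I _ => s i I)
  | Sum.inr z => Sum.inr z

/-- The `m`-th node on the path determined by a strategy profile (the leaf at its end if the path
is shorter). -/
def nodeAt (s : Γ.Profile) : ℕ → Γ.Node
  | 0 => Γ.root
  | m + 1 => Γ.step s (nodeAt s m)

theorem exists_outcome (s : Γ.Profile) : ∃ z m, Γ.nodeAt s m = Sum.inr z := by
  by_contra hcon
  push Not at hcon
  have h1 : ∀ m, ∃ d, Γ.nodeAt s m = Sum.inl d := by
    intro m
    rcases h : Γ.nodeAt s m with d | z
    · exact ⟨d, rfl⟩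
    · exact absurd h (hcon z m)
  choose f hf using h1
  have hstep : ∀ m, Γ.nodeAt s (m + 1) = Γ.child (f m) (fun i I _ => s i I) := by
    intro m
    change Γ.step s (Γ.nodeAt s m) = _
    rw [hf m]
    rfl
  have key : ∀ a c, f a ≠ f (a + (c + 1)) := by
    intro a
    induction a with
    | zero =>
      intro c h
      have h2 := hstep c
      rw [show c + 1 = 0 + (c + 1) by omega, hf, ← h, ← hf] at h2
      exact Γ.root_not_child _ _ h2.symm
    | succ a ih =>
      intro c h
      have h2 := hstep a
      have h3 := hstep (a + (c + 1))
      rw [hf, h, show a + 1 + (c + 1) = a + (c + 1) + 1 by omega, ← hf] at h2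
      have h4 := @Γ.child_injective ⟨f a, fun i I _ => s i I⟩ ⟨f (a + (c + 1)), fun i I _ => s i I⟩
        (h2.symm.trans h3)
      exact ih c (congrArg Sigma.fst h4)
  obtain ⟨a, b, hab, h⟩ := Finite.exists_ne_map_eq_of_infinite f
  rcases Nat.lt_or_gt_of_ne hab with hl | hl
  · exact key a (b - a - 1) (by rw [h]; congr 1; omega)
  · exact key b (a - b - 1) (by rw [← h]; congr 1; omega)

/-- The leaf reached by a strategy profile. -/
noncomputable def outcome (s : Γ.Profile) : Γ.Z := (Γ.exists_outcome s).choose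

/-- The utility of player `i` under a strategy profile. -/
noncomputable def payoff (i : Fin n) (s : Γ.Profile) : ℝ := Γ.u i (Γ.outcome s)

/-- The path determined by a strategy profile goes through the information set `I` of `i`. -/
def Reaches (i : Fin n) (s : Γ.Profile) (I : Γ.Info i) : Prop :=
  ∃ m, Γ.InInfo i I (Γ.nodeAt s m)

/-! ### Conditional dominance

A profile of the opponents of `i` is given by a full profile `τ` whose `i`-th entry is disregarded:
`Function.update τ i σ` is the profile in which `i` plays `σ` and the others play as in `τ`. -/

/-- The profiles of the opponents of `i` in `S` for which `I` is reached if `i` plays `σ`, and also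
if `i` plays any strategy in the support of the mixed strategy `w`. -/
def condOpp (S : ∀ j, Set (Γ.Strat j)) (i : Fin n) (σ : Γ.Strat i) (w : Γ.Strat i → ℝ)
    (I : Γ.Info i) : Set Γ.Profile :=
  {τ | (∀ j, j ≠ i → τ j ∈ S j) ∧ Γ.Reaches i (Function.update τ i σ) I ∧
    ∀ s, w s ≠ 0 → Γ.Reaches i (Function.update τ i s) I}

/-- The strategy `σ` of player `i` is conditionally dominated on `S`. -/
def CondDominated (S : ∀ j, Set (Γ.Strat j)) (i : Fin n) (σ : Γ.Strat i) : Prop :=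
  ∃ (I : Γ.Info i) (w : Γ.Strat i → ℝ), w ∈ stdSimplex ℝ (Γ.Strat i) ∧
    (Γ.condOpp S i σ w I).Nonempty ∧
    ∀ τ ∈ Γ.condOpp S i σ w I,
      Γ.payoff i (Function.update τ i σ) < ∑ s, w s * Γ.payoff i (Function.update τ i s)

/-- The strategies that survive `k` rounds of iterated deletion of conditionally dominated
strategies. -/
def NCD : ℕ → ∀ i, Set (Γ.Strat i)
  | 0, _ => Set.univ
  | k + 1, i => {σ | σ ∈ NCD k i ∧ ¬ Γ.CondDominated (NCD k) i σ}

end ExtGame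

/-! ### Lexicographic probability sequences -/

/-- A lexicographic probability sequence: a finite nonempty sequence of probability measures. -/
@[ext]
structure LPS (X : Type) (F : MeasurableSpace X) where
  toList : List (Measure X)
  ne_nil : toList ≠ []
  prob : ∀ μ ∈ toList, IsProbabilityMeasure μ

namespace LPS

variable {X : Type} {F : MeasurableSpace X}

/-- The first (most important) measure of the sequence. -/
def top (L : LPS X F) : Measure X := L.toList.head L.ne_nil

/-- All measures of the sequence give `A` probability 1 (in the sense of inner measure if `A` is not
measurable). -/
def Certain (L : LPS X F) (A : Set X) : Prop :=
  ∃ E : Set X, MeasurableSet E ∧ E ⊆ A ∧ ∀ μ ∈ L.toList, μ E = 1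

/-- Some measure of the sequence gives `A` positive probability (in the sense of inner measure if
`A` is not measurable). -/
def Possible (L : LPS X F) (A : Set X) : Prop :=
  ∃ E : Set X, MeasurableSet E ∧ E ⊆ A ∧ ∃ μ ∈ L.toList, μ E ≠ 0

end LPS

open Classical in
/-- Conditioning a sequence of measures on `A`: the measures that give `A` probability 0 are dropped
and the others are conditioned on `A`. -/
noncomputable def condList {X : Type} [MeasurableSpace X] (l : List (Measure X)) (A : Set X) :
    List (Measure X) :=
  (l.filter (fun μ => μ A ≠ 0)).map (fun μ => ProbabilityTheory.cond μ A)

/-! ### Structures for a game -/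

/-- A structure for the game `Γ`. -/
structure EpStruct {n : ℕ} (Γ : ExtGame n) where
  /-- states -/
  Ω : Type
  strat : Ω → Γ.Profile
  /-- a σ-algebra on pairs of a state and a time -/
  F : MeasurableSpace (Ω × ℕ)
  /-- the beliefs of each player at each state and time -/
  PR : Fin n → Ω → ℕ → LPS (Ω × ℕ) F

namespace EpStruct

variable {n : ℕ} {Γ : ExtGame n} (M : EpStruct Γ)

def node (ω : M.Ω) (m : ℕ) : Γ.Node := Γ.nodeAt (M.strat ω) m

/-- The structure is appropriate for the game. -/
structure Appropriate : Prop where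
  strat_measurable : ∀ (i : Fin n) (σ : Γ.Strat i),
    MeasurableSet[M.F] {x : M.Ω × ℕ | M.strat x.1 i = σ}
  knows_strat : ∀ i ω m, (M.PR i ω m).Certain {x | M.strat x.1 i = M.strat ω i}
  belief_measurable : ∀ (i : Fin n) (L : LPS (M.Ω × ℕ) M.F),
    MeasurableSet[M.F] {x : M.Ω × ℕ | M.PR i x.1 x.2 = L}
  knows_belief : ∀ i ω m, (M.PR i ω m).Certain {x | M.PR i x.1 x.2 = M.PR i ω m}
  knows_info : ∀ i ω m I, Γ.InInfo i I (M.node ω m) →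
    (M.PR i ω m).Certain {x | Γ.InInfo i I (M.node x.1 x.2)}
  knows_start : ∀ i ω, (M.PR i ω 0).Certain {x | x.2 = 0}
  support_mono : ∀ i ω m (τ : Γ.Profile),
    (M.PR i ω (m + 1)).Possible {x | ∀ j, j ≠ i → M.strat x.1 j = τ j} →
    (M.PR i ω m).Possible {x | ∀ j, j ≠ i → M.strat x.1 j = τ j}

/-- The projections onto the set of states of the measures in the belief of player `i`. The set of
states carries the σ-algebra of all `A` with `A × ℕ` in `F`. -/
noncomputable def proj (i : Fin n) (ω : M.Ω) (m : ℕ) :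
    List (@Measure M.Ω (M.F.map Prod.fst)) :=
  (M.PR i ω m).toList.map (fun μ => @Measure.map (M.Ω × ℕ) M.Ω M.F (M.F.map Prod.fst) Prod.fst μ)

/-- Beliefs do not change where the player does not move, and are updated by conditioning on the
information set where she does. -/
def RespectsConditioning : Prop :=
  ∀ (i : Fin n) (ω : M.Ω) (m : ℕ),
    (¬ Γ.MovesAt i (M.node ω (m + 1)) → M.PR i ω (m + 1) = M.PR i ω m) ∧
    ∀ I, Γ.InInfo i I (M.node ω (m + 1)) →
      M.proj i ω (m + 1) =
        @condList M.Ω (M.F.map Prod.fst) (M.proj i ω m) {ω' | Γ.Reaches i (M.strat ω') I}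

/-- `σ` is a best response for `i`, conditional on reaching `I`, to the belief about the strategies
of the other players that `μ` induces: no strategy that agrees with `σ` at all information sets
preceding `I` has a higher expected utility conditional on reaching `I`. -/
def BestResponse (i : Fin n) (I : Γ.Info i) (σ : Γ.Strat i) (μ : @Measure (M.Ω × ℕ) M.F) : Prop :=
  ∀ σ' : Γ.Strat i, (∀ I', Γ.InfoPrecedes i I' I → σ' I' = σ I') →
    @integral (M.Ω × ℕ) ℝ _ _ M.F
      (@ProbabilityTheory.cond (M.Ω × ℕ) M.F μ
        {x | Γ.Reaches i (Function.update (M.strat x.1) i σ) I})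
      (fun x => Γ.payoff i (Function.update (M.strat x.1) i σ')) ≤
    @integral (M.Ω × ℕ) ℝ _ _ M.F
      (@ProbabilityTheory.cond (M.Ω × ℕ) M.F μ
        {x | Γ.Reaches i (Function.update (M.strat x.1) i σ) I})
      (fun x => Γ.payoff i (Function.update (M.strat x.1) i σ))

/-- Player `i` is rational at `(ω, m)` (trivially so if she does not move there). -/
def Rational (i : Fin n) (ω : M.Ω) (m : ℕ) : Prop :=
  ∀ I, Γ.InInfo i I (M.node ω m) → M.BestResponse i I (M.strat ω i) (M.PR i ω m).top

end EpStruct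

/-! ### Formulas -/

/-- Formulas: truth, rationality, `play`, negation, conjunctions (binary or over a family), belief
`B`, positive probability `P`, satisfiability `dia`, and the temporal operators `init` and `G`. -/
inductive Form {n : ℕ} (Γ : ExtGame n) : Type 1
  | tt : Form Γ
  | rat (i : Fin n) : Form Γ
  | play (i : Fin n) (σ : Γ.Strat i) : Form Γ
  | neg (φ : Form Γ) : Form Γ
  | and (φ ψ : Form Γ) : Form Γ
  | conj (α : Type) (φ : α → Form Γ) : Form Γ
  | B (i : Fin n) (φ : Form Γ) : Form Γ
  | P (i : Fin n) (φ : Form Γ) : Form Γ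
  | dia (φ : Form Γ) : Form Γ
  | init (φ : Form Γ) : Form Γ
  | G (φ : Form Γ) : Form Γ

/-- Truth of a formula at a state and time of a structure. -/
def Sat {n : ℕ} {Γ : ExtGame n} : Form Γ → ∀ M : EpStruct Γ, M.Ω → ℕ → Prop
  | .tt, _, _, _ => True
  | .rat i, M, ω, m => M.Rational i ω m
  | .play i σ, M, ω, _ => M.strat ω i = σ
  | .neg φ, M, ω, m => ¬ Sat φ M ω m
  | .and φ ψ, M, ω, m => Sat φ M ω m ∧ Sat ψ M ω m
  | .conj _ φ, M, ω, m => ∀ a, Sat (φ a) M ω m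
  | .B i φ, M, ω, m => (M.PR i ω m).Certain {x | Sat φ M x.1 x.2}
  | .P i φ, M, ω, m => (M.PR i ω m).Possible {x | Sat φ M x.1 x.2}
  | .dia φ, _, _, _ => ∃ (M' : EpStruct Γ) (ω' : M'.Ω) (m' : ℕ), M'.Appropriate ∧ Sat φ M' ω' m'
  | .init φ, M, ω, _ => Sat φ M ω 0
  | .G φ, M, ω, m => ∀ m', m ≤ m' → Sat φ M ω m'

namespace Form

variable {n : ℕ} {Γ : ExtGame n}

def imp (φ ψ : Form Γ) : Form Γ := neg (and φ (neg ψ))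

/-- The language generated by truth and rationality under negation, conjunction and the belief
operators `B` and `P`. -/
inductive InL1 : Form Γ → Prop
  | tt : InL1 tt
  | rat (i : Fin n) : InL1 (rat i)
  | neg {φ : Form Γ} : InL1 φ → InL1 (neg φ)
  | and {φ ψ : Form Γ} : InL1 φ → InL1 ψ → InL1 (and φ ψ)
  | B (i : Fin n) {φ : Form Γ} : InL1 φ → InL1 (B i φ)
  | P (i : Fin n) {φ : Form Γ} : InL1 φ → InL1 (P i φ)

end Form

/-- Boolean combinations of statements about the strategies played by the opponents of `i`. -/
inductive OppForm {n : ℕ} (Γ : ExtGame n) (i : Fin n) : Type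
  | play (j : Fin n) (hj : j ≠ i) (σ : Γ.Strat j) : OppForm Γ i
  | neg (ψ : OppForm Γ i) : OppForm Γ i
  | and (ψ χ : OppForm Γ i) : OppForm Γ i

def OppForm.toForm {n : ℕ} {Γ : ExtGame n} {i : Fin n} : OppForm Γ i → Form Γ
  | .play j _ σ => .play j σ
  | .neg ψ => .neg ψ.toForm
  | .and ψ χ => .and ψ.toForm χ.toForm

namespace Form

variable {n : ℕ} {Γ : ExtGame n}

/-- All that `i` knows, with respect to statements about the strategies of her opponents, is `φ`. -/
def allIKnow (i : Fin n) (φ : Form Γ) : Form Γ :=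
  and (B i φ) (conj (OppForm Γ i) fun ψ => imp (dia (and φ ψ.toForm)) (P i ψ.toForm))

/-- The conjunction of the `φ j` over the players `j` other than `i`. -/
def others (i : Fin n) (φ : Fin n → Form Γ) : Form Γ := conj {j : Fin n // j ≠ i} fun j => φ j

/-- Player `i` plays a strategy that is consistent with `φ`. -/
def playCon (i : Fin n) (φ : Form Γ) : Form Γ :=
  conj (Γ.Strat i) fun σ => imp (play i σ) (dia (and (play i σ) φ))

/-- The formula expressing level-`k` rationality of player `i`. -/
def RATEFR : ℕ → Fin n → Form Γ
  | 0, _ => tt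
  | k + 1, i => and (init (B i (G (rat i))))
      (and (playCon i (RATEFR k i)) (init (allIKnow i (others i (RATEFR k)))))

end Form

namespace EpStruct

variable {n : ℕ} {Γ : ExtGame n} (M : EpStruct Γ)

/-- All formulas of the language `InL1` define measurable sets. -/
def L1Measurable : Prop :=
  ∀ φ : Form Γ, φ.InL1 → MeasurableSet[M.F] {x : M.Ω × ℕ | Sat φ M x.1 x.2}

end EpStruct

/-- The states `(l, i, s)` with `l ≤ k` and `s` a profile of strategies that survive `l` rounds. -/
abbrev CanonState {n : ℕ} (Γ : ExtGame n) (k : ℕ) : Type :=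
  {p : ℕ × Fin n × Γ.Profile // p.1 ≤ k ∧ ∀ j, p.2.2 j ∈ Γ.NCD p.1 j}

/-- The structure on these states in which `s` is played at `(l, i, s)`, all sets are measurable and
the beliefs are given by `PR`. -/
abbrev canonStruct {n : ℕ} (Γ : ExtGame n) (k : ℕ)
    (PR : Fin n → CanonState Γ k → ℕ → LPS (CanonState Γ k × ℕ) ⊤) : EpStruct Γ where
  Ω := CanonState Γ k
  strat := fun p => p.1.2.2
  F := ⊤
  PR := PR

/-! The implications from (b) down to (e) only drop requirements, so two facts remain: level-`k`
rationality in any appropriate structure forces the strategy into `NCD k` (`RationalitySound`), and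
every strategy in `NCD k` is realised in a canonical structure (`CanonicallyRational`). Neither can
be proved alone, because `O_j` refers to satisfiability in all appropriate structures; the two are
carried together through one induction on `k`.

Soundness (`Appropriate.mem_NCD_succ_of_sat`). Suppose `σ` is dominated at `I`, and let `τ` be an
opponents' profile in the nonempty set on which this happens. The canonical structures make `τ`
compatible with level-`k` rationality of the opponents, so by `O_j` the player initially considers
`τ` possible. Hence there is a state with her initial beliefs and her strategy, where `τ` is played,
`I` is reached and she is rational throughout. Her main belief at `I` is concentrated on surviving
profiles that reach `I`; averaging the dominance over it contradicts the best response property.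

Completeness. By a theorem of the alternative, an undominated `σ` is optimal at each information set
`I` it can reach against some belief `μ I` on surviving profiles that reach `I`. Listing these
beliefs in the order of precedence and ending with one of full support gives a lexicographic belief
against which `σ` is optimal after conditioning on any information set (`exists_beliefs`): the first
measure that survives conditioning on `I` is some `μ J` with `J` equal to `I` or before it, and
optimality from `J` on is inherited at `I`. Full support yields the possibility part of `O_j`.
Conditioning these initial beliefs on the last information set reached gives a structure with all
required properties (`PriorBeliefs`).

In the canonical structure, player `i` at `(l, i, s)` believes in states of level `l` with label
`i`, and every other player `j` in states of level `l - 1` with label `j`; so all players but `i`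
have level-`l` rationality there. Having enough such states requires `NCD k` to be nonempty
(`exists_mem_NCD`). -/

namespace ExtGame

variable {n : ℕ} {Γ : ExtGame n}

/-! ### Paths in the game tree -/

theorem InInfo.unique {i : Fin n} {I J : Γ.Info i} {v : Γ.Node} (h : Γ.InInfo i I v)
    (h' : Γ.InInfo i J v) : I = J := by
  obtain ⟨d, rfl, hd⟩ := h
  obtain ⟨d', hv, hd'⟩ := h'
  obtain rfl := Sum.inl.inj hv
  exact Option.some.inj (hd.symm.trans hd')

theorem nodeAt_succ_of_inl {s : Γ.Profile} {m : ℕ} {d : Γ.D} (h : Γ.nodeAt s m = Sum.inl d) :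
    Γ.nodeAt s (m + 1) = Γ.child d (fun i I _ => s i I) := by
  change Γ.step s (Γ.nodeAt s m) = _
  rw [h]
  rfl

theorem nodeAt_succ_of_inr {s : Γ.Profile} {m : ℕ} {z : Γ.Z} (h : Γ.nodeAt s m = Sum.inr z) :
    Γ.nodeAt s (m + 1) = Sum.inr z := by
  change Γ.step s (Γ.nodeAt s m) = _
  rw [h]
  rfl

theorem nodeAt_of_le_of_inr {s : Γ.Profile} {m m' : ℕ} {z : Γ.Z} (h : Γ.nodeAt s m = Sum.inr z)
    (hm : m ≤ m') : Γ.nodeAt s m' = Sum.inr z := by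
  induction m', hm using Nat.le_induction with
  | base => exact h
  | succ m' _ ih => exact nodeAt_succ_of_inr ih

theorem outcome_eq {s : Γ.Profile} {m : ℕ} {z : Γ.Z} (h : Γ.nodeAt s m = Sum.inr z) :
    Γ.outcome s = z := by
  obtain ⟨m', hm'⟩ := (Γ.exists_outcome s).choose_spec
  have h1 := nodeAt_of_le_of_inr h (le_max_left m m')
  have h2 := nodeAt_of_le_of_inr hm' (le_max_right m m')
  exact Sum.inr.inj (h2.symm.trans h1)

theorem below_nodeAt {s : Γ.Profile} {m m' : ℕ} (h : m ≤ m') :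
    Γ.Below (Γ.nodeAt s m) (Γ.nodeAt s m') := by
  induction m', h using Nat.le_induction with
  | base => exact Relation.ReflTransGen.refl
  | succ m' _ ih =>
    rcases h : Γ.nodeAt s m' with d | z
    · rw [nodeAt_succ_of_inl h]
      rw [h] at ih
      exact ih.tail ⟨d, _, rfl, rfl⟩
    · rw [nodeAt_succ_of_inr h, ← h]
      exact ih

/-- The parent of a node on the path of `s` is on the path, with the move of `s`. -/
theorem eq_nodeAt_of_child {s : Γ.Profile} {m : ℕ} {d : Γ.D} {b : JointMove Γ.Act Γ.info d}
    (h : Γ.child d b = Γ.nodeAt s m) :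
    ∃ m' < m, Γ.nodeAt s m' = Sum.inl d ∧ b = fun i I _ => s i I := by
  induction m with
  | zero => exact absurd h (Γ.root_not_child d b)
  | succ m ih =>
    rcases hm : Γ.nodeAt s m with d' | z
    · rw [nodeAt_succ_of_inl hm] at h
      have h4 := @Γ.child_injective ⟨d, b⟩ ⟨d', fun i I _ => s i I⟩ h
      obtain ⟨rfl, hb⟩ := Sigma.mk.inj h4
      exact ⟨m, m.lt_succ_self, hm, eq_of_heq hb⟩
    · rw [nodeAt_succ_of_inr hm, ← hm] at h
      obtain ⟨m', hm', hh⟩ := ih h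
      exact ⟨m', hm'.trans m.lt_succ_self, hh⟩

theorem exists_nodeAt_of_below {s : Γ.Profile} {x y : Γ.Node} (h : Γ.Below x y) {m : ℕ}
    (hy : y = Γ.nodeAt s m) : ∃ m' ≤ m, Γ.nodeAt s m' = x := by
  induction h generalizing m with
  | refl => exact ⟨m, le_rfl, hy.symm⟩
  | tail _ hbc ih =>
    obtain ⟨d, a, hd, hc⟩ := hbc
    obtain ⟨m', hm', h1, _⟩ := eq_nodeAt_of_child (hc.trans hy)
    obtain ⟨m'', hm'', h2⟩ := ih (hd.trans h1.symm)
    exact ⟨m'', by omega, h2⟩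

theorem choicePrecedes_nodeAt {i : Fin n} {I : Γ.Info i} {s : Γ.Profile} {m m' : ℕ}
    (h : Γ.InInfo i I (Γ.nodeAt s m)) (hm : m < m') :
    Γ.ChoicePrecedes i I (s i I) (Γ.nodeAt s m') := by
  obtain ⟨d, hd, hI⟩ := h
  refine ⟨d, hI, fun i I _ => s i I, rfl, ?_⟩
  rw [← nodeAt_succ_of_inl hd]
  exact below_nodeAt hm

theorem ChoicePrecedes.exists_nodeAt {i : Fin n} {I : Γ.Info i} {a : Γ.Act i I} {s : Γ.Profile}
    {m : ℕ} (h : Γ.ChoicePrecedes i I a (Γ.nodeAt s m)) :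
    s i I = a ∧ ∃ m' < m, Γ.InInfo i I (Γ.nodeAt s m') := by
  obtain ⟨d, hI, b, rfl, hb⟩ := h
  obtain ⟨m1, hm1, h1⟩ := exists_nodeAt_of_below hb rfl
  obtain ⟨m2, hm2, h2, rfl⟩ := eq_nodeAt_of_child h1.symm
  exact ⟨rfl, m2, by omega, d, h2, hI⟩

theorem infoPrecedes_of_lt {i : Fin n} {I J : Γ.Info i} {s : Γ.Profile} {m m' : ℕ}
    (hI : Γ.InInfo i I (Γ.nodeAt s m)) (hJ : Γ.InInfo i J (Γ.nodeAt s m')) (hm : m < m') :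
    Γ.InfoPrecedes i I J :=
  ⟨_, _, hJ, choicePrecedes_nodeAt hI hm⟩

theorem infoPrecedes_trichotomy {i : Fin n} {I J : Γ.Info i} {s : Γ.Profile}
    (hI : Γ.Reaches i s I) (hJ : Γ.Reaches i s J) :
    Γ.InfoPrecedes i I J ∨ I = J ∨ Γ.InfoPrecedes i J I := by
  obtain ⟨m, hm⟩ := hI
  obtain ⟨m', hm'⟩ := hJ
  rcases lt_trichotomy m m' with h | rfl | h
  · exact Or.inl (infoPrecedes_of_lt hm hm' h)
  · exact Or.inr (Or.inl (hm.unique hm'))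
  · exact Or.inr (Or.inr (infoPrecedes_of_lt hm' hm h))

/-! ### Consequences of perfect recall -/

theorem InfoPrecedes.exists_nodeAt (hΓ : Γ.PerfectRecall) {i : Fin n} {I J : Γ.Info i}
    (h : Γ.InfoPrecedes i J I) {s : Γ.Profile} {m : ℕ} (hI : Γ.InInfo i I (Γ.nodeAt s m)) :
    ∃ m' < m, Γ.InInfo i J (Γ.nodeAt s m') := by
  obtain ⟨a, v, hv, ha⟩ := h
  exact (hΓ i I J a v _ hv hI ha).exists_nodeAt.2

theorem InfoPrecedes.reaches (hΓ : Γ.PerfectRecall) {i : Fin n} {I J : Γ.Info i}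
    (h : Γ.InfoPrecedes i J I) {s : Γ.Profile} (hI : Γ.Reaches i s I) : Γ.Reaches i s J := by
  obtain ⟨m, hm⟩ := hI
  obtain ⟨m', _, hm'⟩ := h.exists_nodeAt hΓ hm
  exact ⟨m', hm'⟩

theorem InfoPrecedes.eq_of_reaches (hΓ : Γ.PerfectRecall) {i : Fin n} {I J : Γ.Info i}
    (h : Γ.InfoPrecedes i J I) {s t : Γ.Profile} (hs : Γ.Reaches i s I) (ht : Γ.Reaches i t I) :
    s i J = t i J := by
  obtain ⟨a, v, hv, ha⟩ := h
  obtain ⟨m, hm⟩ := hs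
  obtain ⟨m', hm'⟩ := ht
  rw [(hΓ i I J a v _ hv hm ha).exists_nodeAt.1, (hΓ i I J a v _ hv hm' ha).exists_nodeAt.1]

theorem InfoPrecedes.trans (hΓ : Γ.PerfectRecall) {i : Fin n} {I J K : Γ.Info i}
    (h : Γ.InfoPrecedes i I J) (h' : Γ.InfoPrecedes i J K) : Γ.InfoPrecedes i I K := by
  obtain ⟨a, v, hv, ha⟩ := h
  obtain ⟨a', w, hw, d, hd, b, rfl, hb⟩ := h'
  -- Perfect recall moves the choice at `I` from above `v` to above `d`, the node of `J` that lies
  -- above `w`.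
  obtain ⟨d', hd', b', rfl, hb'⟩ := hΓ i J I a v (Sum.inl d) hv ⟨d, rfl, hd⟩ ha
  exact ⟨_, w, hw, d', hd', b', rfl, (hb'.tail ⟨d, b, rfl, rfl⟩).trans hb⟩

/-- If `I` preceded itself, perfect recall would put another node of `I` strictly above each of its
nodes. Going up the tree ends at the root, so this is impossible. -/
theorem not_infoPrecedes_self (hΓ : Γ.PerfectRecall) {i : Fin n} (I : Γ.Info i) :
    ¬ Γ.InfoPrecedes i I I := by
  rintro ⟨a, v, hv, ha⟩
  have key : ∀ w, Γ.InInfo i I w →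
      ∃ d, Γ.info i d = some I ∧ ∃ b, Γ.Below (Γ.child d b) w := by
    intro w hw
    obtain ⟨d, hd, b, _, hb⟩ := hΓ i I I a v w hv hw ha
    exact ⟨d, hd, b, hb⟩
  have none : ∀ w, ∀ x, Γ.Below x w → ¬ Γ.InInfo i I x := by
    intro w
    induction Γ.reachable w with
    | refl =>
      intro x hx hI
      obtain ⟨d, _, b, hb⟩ := key x hI
      have := hb.trans hx
      rcases this.cases_tail with h | ⟨y, _, d', a', _, h⟩
      · exact Γ.root_not_child _ _ h.symm
      · exact Γ.root_not_child _ _ h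
    | tail hb hbc ih =>
      rename_i y z
      obtain ⟨d', a', rfl, rfl⟩ := hbc
      have up : ∀ x, Γ.Below x (Γ.child d' a') → x = Γ.child d' a' ∨ Γ.Below x (Sum.inl d') := by
        intro x hx
        rcases hx.cases_tail with h | ⟨y, hy, d2, a2, rfl, h⟩
        · exact Or.inl h.symm
        · have := @Γ.child_injective ⟨d2, a2⟩ ⟨d', a'⟩ h
          obtain ⟨rfl, _⟩ := Sigma.mk.inj this
          exact Or.inr hy
      intro x hx hI
      rcases up x hx with rfl | hx
      · obtain ⟨d, hd, b, hb⟩ := key _ hI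
        rcases up _ hb with h | h
        · have := @Γ.child_injective ⟨d, b⟩ ⟨d', a'⟩ h
          obtain ⟨rfl, _⟩ := Sigma.mk.inj this
          exact ih _ Relation.ReflTransGen.refl ⟨d, rfl, hd⟩
        · exact ih (Sum.inl d) (Relation.ReflTransGen.head ⟨d, b, rfl, rfl⟩ h) ⟨d, rfl, hd⟩
      · exact ih x hx hI
  exact none v v Relation.ReflTransGen.refl hv

/-! ### Changing the strategy of one player -/

theorem nodeAt_update_congr {i : Fin n} {τ : Γ.Profile} {σ σ' : Γ.Strat i} {m : ℕ}
    (h : ∀ m' < m, ∀ J, Γ.InInfo i J (Γ.nodeAt (Function.update τ i σ) m') → σ' J = σ J) :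
    Γ.nodeAt (Function.update τ i σ') m = Γ.nodeAt (Function.update τ i σ) m := by
  induction m with
  | zero => rfl
  | succ m ih =>
    have ih' := ih fun m' hm' => h m' (hm'.trans m.lt_succ_self)
    rcases hm : Γ.nodeAt (Function.update τ i σ) m with d | z
    · rw [nodeAt_succ_of_inl hm, nodeAt_succ_of_inl (ih'.trans hm)]
      congr 1
      funext j J hJ
      by_cases hj : j = i
      · subst hj
        simpa using h m m.lt_succ_self J ⟨d, hm, hJ⟩
      · simp [Function.update_of_ne hj]
    · rw [nodeAt_succ_of_inr hm, nodeAt_succ_of_inr (ih'.trans hm)]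

theorem payoff_update_congr {i : Fin n} {τ : Γ.Profile} {σ σ' : Γ.Strat i}
    (h : ∀ J, Γ.Reaches i (Function.update τ i σ) J → σ' J = σ J) :
    Γ.payoff i (Function.update τ i σ') = Γ.payoff i (Function.update τ i σ) := by
  obtain ⟨z, m, hm⟩ := Γ.exists_outcome (Function.update τ i σ)
  have h1 := nodeAt_update_congr (m := m) (σ' := σ') fun m' _ J hJ => h J ⟨m', hJ⟩
  rw [payoff, payoff, outcome_eq hm, outcome_eq (h1.trans hm)]

theorem reaches_update_congr {i : Fin n} {τ : Γ.Profile} {σ σ' : Γ.Strat i} {I : Γ.Info i}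
    (h : ∀ J, Γ.InfoPrecedes i J I → σ' J = σ J) :
    Γ.Reaches i (Function.update τ i σ') I ↔ Γ.Reaches i (Function.update τ i σ) I := by
  have aux : ∀ ρ ρ' : Γ.Strat i, (∀ J, Γ.InfoPrecedes i J I → ρ' J = ρ J) →
      Γ.Reaches i (Function.update τ i ρ) I → Γ.Reaches i (Function.update τ i ρ') I := by
    rintro ρ ρ' h ⟨m, hm⟩
    refine ⟨m, ?_⟩
    rw [nodeAt_update_congr fun m' hm' J hJ => h J (infoPrecedes_of_lt hJ hm hm')]
    exact hm
  exact ⟨aux σ' σ fun J hJ => (h J hJ).symm, aux σ σ' h⟩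

open Classical in
/-- The strategy that follows `σ'` at the information set `I` and at those that come after it, and
`σ` elsewhere. -/
noncomputable def graft {i : Fin n} (I : Γ.Info i) (σ σ' : Γ.Strat i) : Γ.Strat i :=
  fun J => if J = I ∨ Γ.InfoPrecedes i I J then σ' J else σ J

theorem graft_eq_of_infoPrecedes {i : Fin n} {I J : Γ.Info i} {σ σ' : Γ.Strat i}
    (h : ∀ J, Γ.InfoPrecedes i J I → σ' J = σ J) (hJ : Γ.InfoPrecedes i J I) :
    graft I σ σ' J = σ J := by
  rw [graft]
  split_ifs
  · exact h J hJ
  · rfl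

/-- Every information set on a path through `I` is before, equal to or after `I`, and the graft
agrees with `σ'` in each case. -/
theorem payoff_graft_of_reaches {i : Fin n} {I : Γ.Info i} {τ : Γ.Profile} {σ σ' : Γ.Strat i}
    (h : ∀ J, Γ.InfoPrecedes i J I → σ' J = σ J) (hI : Γ.Reaches i (Function.update τ i σ) I) :
    Γ.payoff i (Function.update τ i (graft I σ σ')) = Γ.payoff i (Function.update τ i σ') := by
  refine payoff_update_congr fun J hJ => ?_
  rcases infoPrecedes_trichotomy ((reaches_update_congr h).2 hI) hJ with h1 | rfl | h1
  · rw [graft, if_pos (Or.inr h1)]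
  · rw [graft, if_pos (Or.inl rfl)]
  · rw [graft_eq_of_infoPrecedes h h1, h J h1]

/-- The graft changes `σ` only at `I` and later, and by perfect recall a path that misses `I` misses
all of these. Thus a deviation from `I` on affects only the profiles that reach `I`. -/
theorem payoff_graft_of_not_reaches (hΓ : Γ.PerfectRecall) {i : Fin n} {I : Γ.Info i}
    {τ : Γ.Profile} {σ σ' : Γ.Strat i} (hI : ¬ Γ.Reaches i (Function.update τ i σ) I) :
    Γ.payoff i (Function.update τ i (graft I σ σ')) = Γ.payoff i (Function.update τ i σ) := by
  refine payoff_update_congr fun J hJ => ?_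
  rw [graft, if_neg]
  rintro (rfl | h)
  · exact hI hJ
  · exact hI (h.reaches hΓ hJ)

/-! ### Strategies that survive the iterated deletion -/

theorem NCD_succ_subset (k : ℕ) (i : Fin n) : Γ.NCD (k + 1) i ⊆ Γ.NCD k i := fun _ h => h.1

theorem NCD_anti {k l : ℕ} (h : k ≤ l) (i : Fin n) : Γ.NCD l i ⊆ Γ.NCD k i := by
  induction l, h using Nat.le_induction with
  | base => exact subset_rfl
  | succ l _ ih => exact (NCD_succ_subset l i).trans ih

theorem mem_NCD_of_forall {k : ℕ} {i : Fin n} {σ : Γ.Strat i}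
    (h : ∀ l < k, ¬ Γ.CondDominated (Γ.NCD l) i σ) : σ ∈ Γ.NCD k i := by
  induction k with
  | zero => trivial
  | succ k ih => exact ⟨ih fun l hl => h l (hl.trans k.lt_succ_self), h k k.lt_succ_self⟩

/-- A strategy that reaches an information set whenever a profile with `σ` does agrees with `σ` at
the preceding ones. -/
theorem eq_of_reaches_update (hΓ : Γ.PerfectRecall) {i : Fin n} {I : Γ.Info i} {τ τ' : Γ.Profile}
    {σ s : Γ.Strat i} (h : Γ.Reaches i (Function.update τ i σ) I)
    (h' : Γ.Reaches i (Function.update τ' i s) I) :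
    ∀ J, Γ.InfoPrecedes i J I → s J = σ J := by
  intro J hJ
  simpa using hJ.eq_of_reaches hΓ h' h

theorem mem_condOpp_iff {S : ∀ j, Set (Γ.Strat j)} {i : Fin n} {σ : Γ.Strat i}
    {w : Γ.Strat i → ℝ} {I : Γ.Info i}
    (h : ∀ s, w s ≠ 0 → ∀ J, Γ.InfoPrecedes i J I → s J = σ J) {τ : Γ.Profile} :
    τ ∈ Γ.condOpp S i σ w I ↔
      (∀ j, j ≠ i → τ j ∈ S j) ∧ Γ.Reaches i (Function.update τ i σ) I := by
  refine ⟨fun hτ => ⟨hτ.1, hτ.2.1⟩, fun hτ => ⟨hτ.1, hτ.2, fun s hs => ?_⟩⟩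
  exact (reaches_update_congr (h s hs)).2 hτ.2

open Classical in
/-- The sum of the payoffs of `σ` against the profiles of opponents that survive `l` rounds. -/
noncomputable def totalPayoff (l : ℕ) (i : Fin n) (σ : Γ.Strat i) : ℝ :=
  ∑ τ : Γ.Profile with ∀ j, j ≠ i → τ j ∈ Γ.NCD l j, Γ.payoff i (Function.update τ i σ)

open Classical in
theorem totalPayoff_graft_sub (hΓ : Γ.PerfectRecall) (l : ℕ) {i : Fin n} (I : Γ.Info i)
    {σ s : Γ.Strat i} (h : ∀ J, Γ.InfoPrecedes i J I → s J = σ J) :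
    totalPayoff l i (graft I σ s) - totalPayoff l i σ =
      ∑ τ : Γ.Profile with (∀ j, j ≠ i → τ j ∈ Γ.NCD l j) ∧ Γ.Reaches i (Function.update τ i σ) I,
        (Γ.payoff i (Function.update τ i s) - Γ.payoff i (Function.update τ i σ)) := by
  rw [totalPayoff, totalPayoff, ← Finset.sum_sub_distrib, ← Finset.filter_filter,
    Finset.sum_filter (fun τ => Γ.Reaches i (Function.update τ i σ) I)]
  refine Finset.sum_congr rfl fun τ _ => ?_
  split_ifs with hI
  · rw [payoff_graft_of_reaches h hI]
  · rw [payoff_graft_of_not_reaches hΓ hI, sub_self]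

/-- A maximiser of the payoff totals over the sets of surviving profiles, with priority to the later
rounds, cannot be dominated in any round before `k`: grafting a suitable pure strategy from the
dominating mixture would improve it. -/
theorem exists_mem_NCD (hΓ : Γ.PerfectRecall) (k : ℕ) (i : Fin n) : (Γ.NCD k i).Nonempty := by
  classical
  have : Nonempty (Γ.Strat i) := inferInstance
  -- In the colexicographic order the largest index at which two vectors differ decides.
  obtain ⟨σ, hσ⟩ := Finite.exists_max
    (fun σ : Γ.Strat i => toColex (fun l : Fin k => totalPayoff (l : ℕ) i σ))
  refine ⟨σ, mem_NCD_of_forall fun l hl => ?_⟩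
  rintro ⟨I, w, hw, ⟨τ₀, hτ₀⟩, hdom⟩
  have hpre : ∀ s, w s ≠ 0 → ∀ J, Γ.InfoPrecedes i J I → s J = σ J := fun s hs =>
    eq_of_reaches_update hΓ hτ₀.2.1 (hτ₀.2.2 s hs)
  let P : ℕ → Prop := fun l' => ∃ τ : Γ.Profile, (∀ j, j ≠ i → τ j ∈ Γ.NCD l' j) ∧
    Γ.Reaches i (Function.update τ i σ) I
  have hP : P l := ⟨τ₀, hτ₀.1, hτ₀.2.1⟩
  -- The last round below `k` in which some surviving opponents' profile still reaches `I` with `σ`.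
  -- A deviation at `I` leaves all later totals unchanged, so the total of round `L` decides.
  set L := Nat.findGreatest P (k - 1) with hL
  obtain ⟨τ₁, hτ₁⟩ : P L := Nat.findGreatest_spec (m := l) (by omega) hP
  have hlL : l ≤ L := Nat.le_findGreatest (by omega) hP
  have hLk : L < k := by
    have := Nat.findGreatest_le (P := P) (k - 1)
    omega
  set T : Finset Γ.Profile := {τ : Γ.Profile | (∀ j, j ≠ i → τ j ∈ Γ.NCD L j) ∧
    Γ.Reaches i (Function.update τ i σ) I} with hT
  have hsum : ∑ τ ∈ T, Γ.payoff i (Function.update τ i σ) <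
      ∑ τ ∈ T, ∑ s, w s * Γ.payoff i (Function.update τ i s) := by
    refine Finset.sum_lt_sum_of_nonempty ⟨τ₁, by simpa [hT] using hτ₁⟩ fun τ hτ => hdom τ ?_
    rw [mem_condOpp_iff hpre]
    simp only [hT, Finset.mem_filter, Finset.mem_univ, true_and] at hτ
    exact ⟨fun j hj => NCD_anti hlL j (hτ.1 j hj), hτ.2⟩
  obtain ⟨s, hs, hlt⟩ : ∃ s, w s ≠ 0 ∧ ∑ τ ∈ T, Γ.payoff i (Function.update τ i σ) <
      ∑ τ ∈ T, Γ.payoff i (Function.update τ i s) := by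
    by_contra! hcon
    refine hsum.not_ge ?_
    rw [Finset.sum_comm]
    calc ∑ s, ∑ τ ∈ T, w s * Γ.payoff i (Function.update τ i s)
        ≤ ∑ s, w s * ∑ τ ∈ T, Γ.payoff i (Function.update τ i σ) := by
          refine Finset.sum_le_sum fun s _ => ?_
          rw [← Finset.mul_sum]
          by_cases hs : w s = 0
          · simp [hs]
          · exact mul_le_mul_of_nonneg_left (hcon s hs) (hw.1 s)
      _ = _ := by rw [← Finset.sum_mul, hw.2, one_mul]
  refine (hσ (graft I σ s)).not_gt ?_
  refine ⟨⟨L, hLk⟩, fun l' hl' => ?_, ?_⟩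
  · refine (sub_eq_zero.1 ?_).symm
    refine (totalPayoff_graft_sub hΓ l' I (hpre s hs)).trans (Finset.sum_eq_zero ?_)
    intro τ hτ
    simp only [Finset.mem_filter, Finset.mem_univ, true_and] at hτ
    have h1 : L < (l' : ℕ) := hl'
    exact absurd ⟨τ, hτ⟩ (Nat.findGreatest_is_greatest h1 (by omega))
  · refine sub_pos.1 ?_
    refine lt_of_lt_of_eq ?_ (totalPayoff_graft_sub hΓ L I (hpre s hs)).symm
    rw [Finset.sum_sub_distrib]
    exact sub_pos.2 hlt

end ExtGame

/-! ### Linear duality -/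

/-- A theorem of the alternative for two-player games: if no mixture of the rows in `S` is positive
in every column, then some mixture of the columns is nonpositive in every row in `S`. -/
theorem exists_mem_stdSimplex_sum_nonpos {X Y : Type*} [Fintype X] [Fintype Y] (g : Y → X → ℝ)
    {S : Set Y} (hS : S.Nonempty)
    (h : ¬ ∃ w ∈ stdSimplex ℝ Y, (∀ y, w y ≠ 0 → y ∈ S) ∧ ∀ x, 0 < ∑ y, w y * g y x) :
    ∃ p ∈ stdSimplex ℝ X, ∀ y ∈ S, ∑ x, p x * g y x ≤ 0 := by
  classical
  let C : Set (X → ℝ) := {v | ∀ x, 0 < v x}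
  let L : (Y → ℝ) →ₗ[ℝ] (X → ℝ) :=
    { toFun := fun w x => ∑ y, w y * g y x
      map_add' := fun a b => by
        funext x
        simp [add_mul, Finset.sum_add_distrib]
      map_smul' := fun c a => by
        funext x
        simp [mul_assoc, Finset.mul_sum] }
  let W : Set (Y → ℝ) := {w | w ∈ stdSimplex ℝ Y ∧ ∀ y, w y ≠ 0 → y ∈ S}
  have hC : Convex ℝ C := by
    have : C = ⋂ x, {v : X → ℝ | 0 < v x} := by
      ext v
      simp [C]
    rw [this]
    exact convex_iInter fun x => convex_halfSpace_gt (LinearMap.proj x : (X → ℝ) →ₗ[ℝ] ℝ).isLinear 0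
  have hCo : IsOpen C := by
    have : C = ⋂ x, {v : X → ℝ | 0 < v x} := by
      ext v
      simp [C]
    rw [this]
    exact isOpen_iInter_of_finite fun x => isOpen_lt continuous_const (continuous_apply x)
  have hW : Convex ℝ W := by
    intro a ha b hb s t hs ht hst
    refine ⟨convex_stdSimplex ℝ Y ha.1 hb.1 hs ht hst, fun y hy => ?_⟩
    by_contra hyS
    have h1 : a y = 0 := by_contra fun h1 => hyS (ha.2 y h1)
    have h2 : b y = 0 := by_contra fun h2 => hyS (hb.2 y h2)
    simp [h1, h2] at hy
  have hsingle : ∀ y ∈ S, L (Pi.single y 1) ∈ L '' W := by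
    intro y hy
    refine ⟨_, ⟨single_mem_stdSimplex ℝ y, fun y' hy' => ?_⟩, rfl⟩
    by_contra hne
    have : y' ≠ y := fun h => hne (h ▸ hy)
    simp [this] at hy'
  have hLsingle : ∀ y, L (Pi.single y 1) = g y := by
    intro y
    funext x
    change ∑ y', (Pi.single y (1 : ℝ) : Y → ℝ) y' * g y' x = g y x
    simp [Pi.single_apply]
  -- By hypothesis no payoff vector of a mixture over `S` lies in the open positive orthant. The
  -- coefficients of a separating functional, normalised, will be the mixture of columns.
  obtain ⟨f, u, hf, hu⟩ := geometric_hahn_banach_open hC hCo (hW.linear_image L) (by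
    rw [Set.disjoint_left]
    rintro _ hv ⟨w, hw, rfl⟩
    exact h ⟨w, hw.1, hw.2, hv⟩)
  -- The orthant is a cone: scaling up shows that a functional bounded above on it is nonpositive
  -- there, and scaling down gives `0 ≤ u` below.
  have hscale : ∀ v ∈ C, f v ≤ 0 := by
    intro v hv
    by_contra! hpos
    have hc : 0 < (|u| + 1) / f v := by positivity
    have h1 := hf (((|u| + 1) / f v) • v) fun x => mul_pos hc (hv x)
    rw [map_smul, smul_eq_mul, div_mul_cancel₀ _ hpos.ne'] at h1
    linarith [le_abs_self u]
  have hu0 : 0 ≤ u := by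
    by_contra! hneg
    have h1 := hf 1 (fun x => one_pos)
    have h2 := hscale 1 (fun x => one_pos)
    have h3 : f 1 < 0 := by linarith
    have hc : 0 < u / (2 * f 1) := div_pos_of_neg_of_neg hneg (by linarith)
    have h4 := hf ((u / (2 * f 1)) • (1 : X → ℝ)) fun x => mul_pos hc one_pos
    rw [map_smul, smul_eq_mul] at h4
    have h5 : u / (2 * f 1) * f 1 = u / 2 := by
      have := h3.ne
      field_simp
    linarith
  have hrep : ∀ v : X → ℝ, f v = ∑ x, v x * f (Pi.single x 1) := by
    intro v
    conv_lhs => rw [pi_eq_sum_univ' v]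
    simp
  have hcoord : ∀ x, f (Pi.single x 1) ≤ 0 := by
    intro x
    have hcl : ∀ ε : ℝ, 0 < ε → f (Pi.single x 1) + ε * f 1 ≤ 0 := by
      intro ε hε
      have := hscale (Pi.single x 1 + ε • (1 : X → ℝ)) fun x' => by
        by_cases hx : x' = x <;> simp [hx] <;> positivity
      simpa using this
    by_contra! hpos
    have h2 := hscale 1 (fun x => one_pos)
    -- The basis vector is only on the boundary of the orthant. This `ε` is small enough for `f
    -- (Pi.single x 1) + ε * f 1` to remain positive.
    have h1 := hcl (f (Pi.single x 1) / (2 * (1 - f 1))) (by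
      apply div_pos hpos
      linarith)
    have h3 : f (Pi.single x 1) / (2 * (1 - f 1)) * f 1 =
        f (Pi.single x 1) * (f 1 / (2 * (1 - f 1))) := by ring
    have h4 : -1 < f 1 / (2 * (1 - f 1)) := by
      rw [lt_div_iff₀ (by linarith)]
      linarith
    nlinarith
  obtain ⟨y₀, hy₀⟩ := hS
  have hneg : ∑ x, f (Pi.single x 1) < 0 := by
    by_contra! hge
    have hz : ∀ x, f (Pi.single x 1) = 0 := by
      have h1 : ∑ x, f (Pi.single x 1) = 0 := le_antisymm (Finset.sum_nonpos fun x _ => hcoord x) hge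
      intro x
      exact (Finset.sum_eq_zero_iff_of_nonpos fun x _ => hcoord x).1 h1 x (Finset.mem_univ x)
    have hzero : ∀ v, f v = 0 := fun v => by
      rw [hrep]
      simp [hz]
    have h1 := hf 1 (fun x => one_pos)
    have h2 := hu _ (hsingle y₀ hy₀)
    rw [hzero] at h1 h2
    linarith
  set c := ∑ x, f (Pi.single x 1) with hc
  refine ⟨fun x => f (Pi.single x 1) / c, ⟨fun x => div_nonneg_of_nonpos (hcoord x) hneg.le, ?_⟩, ?_⟩
  · rw [← Finset.sum_div, ← hc, div_self hneg.ne]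
  · intro y hy
    have h1 := hu _ (hsingle y hy)
    rw [hLsingle, hrep] at h1
    have h2 : ∑ x, f (Pi.single x 1) / c * g y x = (∑ x, g y x * f (Pi.single x 1)) / c := by
      rw [Finset.sum_div]
      exact Finset.sum_congr rfl fun x _ => by ring
    rw [h2]
    exact div_nonpos_of_nonneg_of_nonpos (hu0.trans h1) hneg.le

/-! ### Certain and possible events -/

namespace LPS

variable {X : Type} {F : MeasurableSpace X} {L : LPS X F} {A B : Set X}

theorem Certain.mono (h : L.Certain A) (hAB : A ⊆ B) : L.Certain B := by
  obtain ⟨E, hE, hEA, h1⟩ := h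
  exact ⟨E, hE, hEA.trans hAB, h1⟩

theorem Certain.inter (hA : L.Certain A) (hB : L.Certain B) : L.Certain (A ∩ B) := by
  obtain ⟨E, hE, hEA, h1⟩ := hA
  obtain ⟨E', hE', hEB, h2⟩ := hB
  refine ⟨E ∩ E', hE.inter hE', Set.inter_subset_inter hEA hEB, fun μ hμ => ?_⟩
  have := L.prob μ hμ
  rw [measure_inter_conull ((prob_compl_eq_zero_iff hE').2 (h2 μ hμ)), h1 μ hμ]

theorem Certain.possible (h : L.Certain A) : L.Possible A := by
  obtain ⟨E, hE, hEA, h1⟩ := h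
  refine ⟨E, hE, hEA, L.toList.head L.ne_nil, List.head_mem _, ?_⟩
  rw [h1 _ (List.head_mem _)]
  exact one_ne_zero

theorem Possible.inter_certain (hA : L.Possible A) (hB : L.Certain B) : L.Possible (A ∩ B) := by
  obtain ⟨E, hE, hEA, μ, hμ, h1⟩ := hA
  obtain ⟨E', hE', hEB, h2⟩ := hB
  refine ⟨E ∩ E', hE.inter hE', Set.inter_subset_inter hEA hEB, μ, hμ, ?_⟩
  have := L.prob μ hμ
  have h3 : μ E'ᶜ = 0 := (prob_compl_eq_zero_iff hE').2 (h2 μ hμ)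
  rwa [measure_inter_conull h3]

theorem Possible.nonempty (h : L.Possible A) : A.Nonempty := by
  obtain ⟨E, _, hEA, μ, _, h1⟩ := h
  exact (nonempty_of_measure_ne_zero h1).mono hEA

theorem Certain.ae (h : L.Certain A) {μ : Measure X} (hμ : μ ∈ L.toList) : ∀ᵐ x ∂μ, x ∈ A := by
  obtain ⟨E, hE, hEA, h1⟩ := h
  have := L.prob μ hμ
  filter_upwards [(prob_compl_eq_zero_iff hE).2 (h1 μ hμ)] with x hx
  exact hEA hx

end LPS

theorem ProbabilityTheory.cond_eq_self_of_ae_mem {X : Type*} [MeasurableSpace X] {μ : Measure X}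
    [IsProbabilityMeasure μ] {A : Set X} (hA : MeasurableSet A) (h : ∀ᵐ x ∂μ, x ∈ A) :
    ProbabilityTheory.cond μ A = μ := by
  rw [ProbabilityTheory.cond, (prob_compl_eq_zero_iff hA).1 h, inv_one, one_smul,
    Measure.restrict_eq_self_of_ae_mem h]

theorem integrable_comp_of_finite {X Y : Type*} [MeasurableSpace X] {μ : Measure X}
    [IsFiniteMeasure μ] [Finite Y] {s : X → Y} (hs : ∀ A : Set Y, MeasurableSet (s ⁻¹' A))
    (f : Y → ℝ) : Integrable (fun x => f (s x)) μ := by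
  obtain ⟨C, hC⟩ := (Set.finite_range fun y => ‖f y‖).bddAbove
  refine Integrable.of_bound (Measurable.aestronglyMeasurable fun A _ => hs (f ⁻¹' A)) C ?_
  exact Filter.Eventually.of_forall fun x => hC ⟨s x, rfl⟩

/-! ### Dominance against best responses -/

namespace ExtGame

variable {n : ℕ} {Γ : ExtGame n}

/-- Each pure strategy in the support of `w` is an admissible deviation, so on average `w` does no
better than `σ` under `μ`; yet its advantage is positive almost everywhere. The conditioning in
`hbest` has no effect, since `μ` already gives reaching `I` probability one. -/
theorem false_of_dominated_of_bestResponse {X : Type*} [MeasurableSpace X] {μ : Measure X}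
    [IsProbabilityMeasure μ] {s : X → Γ.Profile} (hs : ∀ A : Set Γ.Profile, MeasurableSet (s ⁻¹' A))
    {S : ∀ j, Set (Γ.Strat j)} {i : Fin n} {σ : Γ.Strat i} {w : Γ.Strat i → ℝ} {I : Γ.Info i}
    (hw : w ∈ stdSimplex ℝ (Γ.Strat i))
    (hpre : ∀ ρ, w ρ ≠ 0 → ∀ J, Γ.InfoPrecedes i J I → ρ J = σ J)
    (hdom : ∀ τ ∈ Γ.condOpp S i σ w I, Γ.payoff i (Function.update τ i σ) <
      ∑ ρ, w ρ * Γ.payoff i (Function.update τ i ρ))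
    (hopp : ∀ᵐ x ∂μ, ∀ j, j ≠ i → s x j ∈ S j)
    (hreach : ∀ᵐ x ∂μ, Γ.Reaches i (Function.update (s x) i σ) I)
    (hbest : ∀ σ' : Γ.Strat i, (∀ J, Γ.InfoPrecedes i J I → σ' J = σ J) →
      ∫ x, Γ.payoff i (Function.update (s x) i σ')
        ∂(ProbabilityTheory.cond μ {x | Γ.Reaches i (Function.update (s x) i σ) I}) ≤
      ∫ x, Γ.payoff i (Function.update (s x) i σ)
        ∂(ProbabilityTheory.cond μ {x | Γ.Reaches i (Function.update (s x) i σ) I})) : False := by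
  rw [ProbabilityTheory.cond_eq_self_of_ae_mem
    (A := {x | Γ.Reaches i (Function.update (s x) i σ) I})
    (hs {τ | Γ.Reaches i (Function.update τ i σ) I}) hreach] at hbest
  have hint : ∀ ρ : Γ.Strat i, Integrable (fun x => Γ.payoff i (Function.update (s x) i ρ)) μ :=
    fun ρ => integrable_comp_of_finite hs fun τ => Γ.payoff i (Function.update τ i ρ)
  have hint' : Integrable (fun x => ∑ ρ, w ρ * Γ.payoff i (Function.update (s x) i ρ)) μ :=
    integrable_finsetSum _ fun ρ _ => (hint ρ).const_mul _
  have hpos : ∀ᵐ x ∂μ, 0 < ∑ ρ, w ρ * Γ.payoff i (Function.update (s x) i ρ) -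
      Γ.payoff i (Function.update (s x) i σ) := by
    filter_upwards [hopp, hreach] with x h1 h2
    exact sub_pos.2 (hdom (s x) ((mem_condOpp_iff hpre).2 ⟨h1, h2⟩))
  have hle : ∫ x, (∑ ρ, w ρ * Γ.payoff i (Function.update (s x) i ρ) -
      Γ.payoff i (Function.update (s x) i σ)) ∂μ ≤ 0 := by
    rw [integral_sub hint' (hint σ), integral_finsetSum _ fun ρ _ => (hint ρ).const_mul _]
    simp only [integral_const_mul]
    rw [sub_nonpos]
    calc ∑ ρ, w ρ * ∫ x, Γ.payoff i (Function.update (s x) i ρ) ∂μ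
        ≤ ∑ ρ, w ρ * ∫ x, Γ.payoff i (Function.update (s x) i σ) ∂μ := by
          refine Finset.sum_le_sum fun ρ _ => ?_
          by_cases hρ : w ρ = 0
          · simp [hρ]
          · exact mul_le_mul_of_nonneg_left (hbest ρ (hpre ρ hρ)) (hw.1 ρ)
      _ = _ := by rw [← Finset.sum_mul, hw.2, one_mul]
  have hnn := hpos.mono fun x hx => hx.le
  have hzero := (integral_eq_zero_iff_of_nonneg_ae hnn (hint'.sub (hint σ))).1
    (le_antisymm hle (integral_nonneg_of_ae hnn))
  obtain ⟨x, hx, hx'⟩ := (hpos.and hzero).exists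
  exact hx.ne' hx'

end ExtGame

/-! ### Formulas about strategies -/

theorem Sat_imp {n : ℕ} {Γ : ExtGame n} {φ ψ : Form Γ} {M : EpStruct Γ} {ω : M.Ω} {m : ℕ} :
    Sat (Form.imp φ ψ) M ω m ↔ (Sat φ M ω m → Sat ψ M ω m) := by
  simp [Form.imp, Sat]

theorem Sat_others {n : ℕ} {Γ : ExtGame n} {i : Fin n} {φ : Fin n → Form Γ} {M : EpStruct Γ}
    {ω : M.Ω} {m : ℕ} : Sat (Form.others i φ) M ω m ↔ ∀ j, j ≠ i → Sat (φ j) M ω m := by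
  simp [Form.others, Sat]

/-- The truth of a statement about the opponents' strategies depends on these strategies only. -/
theorem OppForm.sat_congr {n : ℕ} {Γ : ExtGame n} {i : Fin n} (ψ : OppForm Γ i)
    {M M' : EpStruct Γ} {ω : M.Ω} {ω' : M'.Ω} {m m' : ℕ}
    (h : ∀ j, j ≠ i → M.strat ω j = M'.strat ω' j) :
    Sat ψ.toForm M ω m ↔ Sat ψ.toForm M' ω' m' := by
  induction ψ with
  | play j hj σ => simp [OppForm.toForm, Sat, h j hj]
  | neg ψ ih => simp [OppForm.toForm, Sat, ih]
  | and ψ χ ih ih' => simp [OppForm.toForm, Sat, ih, ih']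

/-- The opponents' profile can be described by a formula. -/
theorem OppForm.exists_describes {n : ℕ} {Γ : ExtGame n} {i : Fin n} (τ : Γ.Profile)
    (hi : ∃ j, j ≠ i) : ∃ ψ : OppForm Γ i, ∀ (M : EpStruct Γ) (ω : M.Ω) (m : ℕ),
      Sat ψ.toForm M ω m ↔ ∀ j, j ≠ i → M.strat ω j = τ j := by
  have key : ∀ T : Finset {j : Fin n // j ≠ i}, T.Nonempty → ∃ ψ : OppForm Γ i,
      ∀ (M : EpStruct Γ) (ω : M.Ω) (m : ℕ),
        Sat ψ.toForm M ω m ↔ ∀ j ∈ T, M.strat ω j = τ j := by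
    intro T hT
    induction hT using Finset.Nonempty.cons_induction with
    | singleton j => exact ⟨.play j j.2 (τ j), fun M ω m => by simp [OppForm.toForm, Sat]⟩
    | cons j T hj hT ih =>
      obtain ⟨ψ, hψ⟩ := ih
      exact ⟨.and (.play j j.2 (τ j)) ψ, fun M ω m => by simp [OppForm.toForm, Sat, hψ]⟩
  obtain ⟨j, hj⟩ := hi
  obtain ⟨ψ, hψ⟩ := key Finset.univ ⟨⟨j, hj⟩, Finset.mem_univ _⟩
  exact ⟨ψ, fun M ω m => by simp [hψ]⟩

/-! ### Soundness of level-`k` rationality -/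

namespace EpStruct

variable {n : ℕ} {Γ : ExtGame n} {M : EpStruct Γ}

theorem Appropriate.measurableSet_strat (hM : M.Appropriate) (A : Set Γ.Profile) :
    MeasurableSet[M.F] ((fun x : M.Ω × ℕ => M.strat x.1) ⁻¹' A) := by
  let _ := M.F
  have : (fun x : M.Ω × ℕ => M.strat x.1) ⁻¹' A =
      ⋃ τ ∈ A, ⋂ j, {x : M.Ω × ℕ | M.strat x.1 j = τ j} := by
    ext x
    simp only [Set.mem_preimage, Set.mem_iUnion, Set.mem_iInter, Set.mem_ofPred_eq, exists_prop,
      ← funext_iff]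
    simp
  rw [this]
  exact (Set.toFinite A).measurableSet_biUnion fun τ _ =>
    MeasurableSet.iInter fun j => hM.strat_measurable j (τ j)

theorem Appropriate.possible_anti (hM : M.Appropriate) (i : Fin n) (ω : M.Ω) (τ : Γ.Profile)
    {m m' : ℕ} (hm : m ≤ m')
    (h : (M.PR i ω m').Possible {x | ∀ j, j ≠ i → M.strat x.1 j = τ j}) :
    (M.PR i ω m).Possible {x | ∀ j, j ≠ i → M.strat x.1 j = τ j} := by
  induction m', hm using Nat.le_induction with
  | base => exact h
  | succ m' _ ih => exact ih (hM.support_mono i ω m' τ h)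

/-- If all that a player knows initially is that her opponents play strategies with a property that
the profile `τ` has, then she considers `τ` possible. -/
theorem Appropriate.possible_of_allIKnow (hM : M.Appropriate) {i : Fin n} {ω : M.Ω} {φ : Form Γ}
    (h : Sat (Form.allIKnow i φ) M ω 0) {M' : EpStruct Γ} (hM' : M'.Appropriate) {ω' : M'.Ω}
    {m' : ℕ} (hφ : Sat φ M' ω' m') :
    (M.PR i ω 0).Possible {x | ∀ j, j ≠ i → M.strat x.1 j = M'.strat ω' j} := by
  -- Without opponents `OppForm` is empty, as it has no constant for truth; the event is then the
  -- whole space.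
  by_cases hi : ∃ j, j ≠ i
  · obtain ⟨ψ, hψ⟩ := OppForm.exists_describes (M'.strat ω') hi
    have h1 := Sat_imp.1 (h.2 ψ) ⟨M', ω', m', hM', hφ, (hψ M' ω' m').2 fun _ _ => rfl⟩
    simp only [Sat, hψ] at h1
    exact h1
  · push Not at hi
    refine LPS.Certain.possible ((hM.knows_start i ω).mono ?_)
    exact fun x _ j hj => absurd (hi j) hj

/-- The induction step for soundness. Besides soundness at level `k` (`ih`) it needs a converse
(`hex`): only if the surviving profiles are satisfiable does `O_j` force the player to consider them
possible. -/
theorem Appropriate.mem_NCD_succ_of_sat (hΓ : Γ.PerfectRecall) {k : ℕ}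
    (ih : ∀ (M : EpStruct Γ) (ω : M.Ω) (m : ℕ) (j : Fin n), M.Appropriate →
      Sat (Form.RATEFR k j) M ω m → M.strat ω j ∈ Γ.NCD k j)
    (hex : ∀ (i : Fin n) (τ : Γ.Profile), (∀ j, τ j ∈ Γ.NCD k j) →
      ∃ (M : EpStruct Γ) (ω : M.Ω) (m : ℕ), M.Appropriate ∧
        Sat (Form.others i (Form.RATEFR k)) M ω m ∧ M.strat ω = τ)
    (hM : M.Appropriate) {i : Fin n} {ω : M.Ω} {m : ℕ}
    (h : Sat (Form.RATEFR (k + 1) i) M ω m) : M.strat ω i ∈ Γ.NCD (k + 1) i := by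
  obtain ⟨hrat, hplay, hknow⟩ := h
  have hk : M.strat ω i ∈ Γ.NCD k i := by
    obtain ⟨M', ω', m', hM', h1, h2⟩ := Sat_imp.1 (hplay (M.strat ω i)) rfl
    exact h1 ▸ ih M' ω' m' i hM' h2
  refine ⟨hk, ?_⟩
  rintro ⟨I, w, hw, ⟨τ, hτ⟩, hdom⟩
  have hpre : ∀ s, w s ≠ 0 → ∀ J, Γ.InfoPrecedes i J I → s J = M.strat ω i J := fun s hs =>
    ExtGame.eq_of_reaches_update hΓ hτ.2.1 (hτ.2.2 s hs)
  obtain ⟨M', ω', m', hM', h1, h2⟩ := hex i (Function.update τ i (M.strat ω i)) fun j => by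
    by_cases hj : j = i
    · subst hj
      simpa using hk
    · simpa [Function.update_of_ne hj] using hτ.1 j hj
  have hposs := hM.possible_of_allIKnow hknow hM' h1
  rw [h2] at hposs
  have hcert := ((hM.knows_strat i ω 0).inter (hM.knows_belief i ω 0)).inter
    ((hM.knows_start i ω).inter hrat)
  -- The path at `ω` itself need not reach `I`. The argument moves to a state `ω₁` that does reach
  -- it, at which strategy and initial beliefs of `i` are unchanged and she is rational at all
  -- times.
  obtain ⟨⟨ω₁, t⟩, hopp, ⟨hstrat, hbel⟩, ht, hratx⟩ := (hposs.inter_certain hcert).nonempty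
  change t = 0 at ht
  subst ht
  change M.strat ω₁ i = M.strat ω i at hstrat
  change M.PR i ω₁ 0 = M.PR i ω 0 at hbel
  have hs₁ : M.strat ω₁ = Function.update τ i (M.strat ω i) := by
    funext j
    by_cases hj : j = i
    · subst hj
      simpa using hstrat
    · exact hopp j hj
  obtain ⟨m₁, hm₁⟩ := hτ.2.1
  rw [← hs₁] at hm₁
  have hbest := hratx m₁ (Nat.zero_le _) I hm₁
  let _ := M.F
  have hmem : (M.PR i ω₁ m₁).top ∈ (M.PR i ω₁ m₁).toList := List.head_mem _
  have := (M.PR i ω₁ m₁).prob _ hmem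
  rw [BestResponse, hstrat] at hbest
  refine ExtGame.false_of_dominated_of_bestResponse (s := fun x : M.Ω × ℕ => M.strat x.1)
    hM.measurableSet_strat hw hpre hdom ?_ ?_ hbest
  -- The event that the opponents satisfy `RATEFR k` need not be measurable, so each of the finitely
  -- many profiles is treated separately. One that is possible at time `m₁` was possible at time
  -- `0`, where the opponents' rationality is certain.
  · have hnull : ∀ τ' : Γ.Profile, ∀ᵐ x ∂(M.PR i ω₁ m₁).top,
        (∀ j, j ≠ i → M.strat x.1 j = τ' j) → ∀ j, j ≠ i → M.strat x.1 j ∈ Γ.NCD k j := by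
      intro τ'
      by_cases hτ' : ∀ j, j ≠ i → τ' j ∈ Γ.NCD k j
      · exact Filter.Eventually.of_forall fun x hx j hj => hx j hj ▸ hτ' j hj
      · have h0 : (M.PR i ω₁ m₁).top {x | ∀ j, j ≠ i → M.strat x.1 j = τ' j} = 0 := by
          by_contra hne
          have hp := hM.possible_anti i ω₁ τ' (Nat.zero_le m₁)
            ⟨_, hM.measurableSet_strat {ρ | ∀ j, j ≠ i → ρ j = τ' j}, subset_rfl, _, hmem, hne⟩
          rw [hbel] at hp
          obtain ⟨x, hx, hx'⟩ := (hp.inter_certain hknow.1).nonempty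
          refine hτ' fun j hj => ?_
          rw [← hx j hj]
          exact ih M x.1 x.2 j hM (Sat_others.1 hx' j hj)
        filter_upwards [measure_eq_zero_iff_ae_notMem.1 h0] with x hx hx'
        exact absurd hx' hx
    filter_upwards [ae_all_iff.2 hnull] with x hx
    exact hx (M.strat x.1) fun _ _ => rfl
  · filter_upwards [(hM.knows_strat i ω₁ m₁).ae hmem, (hM.knows_info i ω₁ m₁ I hm₁).ae hmem]
      with x hx hx'
    rw [← hstrat, ← show M.strat x.1 i = M.strat ω₁ i from hx, Function.update_eq_self]
    exact ⟨x.2, hx'⟩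

end EpStruct

/-! ### Finitely supported beliefs -/

theorem exists_measure_of_mem_stdSimplex {X Ω : Type*} [Fintype X] [Finite Ω] [MeasurableSpace Ω]
    [DiscreteMeasurableSpace Ω] (f : X → Ω) {p : X → ℝ} (hp : p ∈ stdSimplex ℝ X) :
    ∃ ν : Measure Ω, IsProbabilityMeasure ν ∧ ν (Set.range f)ᶜ = 0 ∧
      (∀ x, p x ≠ 0 → ν {f x} ≠ 0) ∧ ∀ g : Ω → ℝ, ∫ ω, g ω ∂ν = ∑ x, p x * g (f x) := by
  classical
  let ν : Measure Ω := ∑ x, ENNReal.ofReal (p x) • Measure.dirac (f x)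
  have hν : ∀ A : Set Ω, ν A = ∑ x, ENNReal.ofReal (p x) * A.indicator 1 (f x) := fun A => by
    simp [ν, Measure.dirac_apply' _ (MeasurableSet.of_discrete (s := A))]
  refine ⟨ν, ⟨?_⟩, ?_, fun x hx => ?_, fun g => ?_⟩
  · rw [hν]
    simp only [Set.indicator_univ, Pi.one_apply, mul_one]
    rw [← ENNReal.ofReal_sum_of_nonneg fun x _ => hp.1 x, hp.2, ENNReal.ofReal_one]
  · rw [hν]
    simp
  · rw [hν]
    intro h0
    have h1 := (Finset.sum_eq_zero_iff.1 h0) x (Finset.mem_univ x)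
    simp only [Set.indicator_of_mem (Set.mem_singleton (f x)), Pi.one_apply, mul_one,
      ENNReal.ofReal_eq_zero] at h1
    exact hx (le_antisymm h1 (hp.1 x))
  · rw [integral_finsetSum_measure]
    · refine Finset.sum_congr rfl fun x _ => ?_
      rw [integral_smul_measure, integral_dirac' _ _ (StronglyMeasurable.of_discrete),
        ENNReal.toReal_ofReal (hp.1 x), smul_eq_mul]
    · intro x _
      refine Integrable.smul_measure ?_ ENNReal.ofReal_ne_top
      exact integrable_dirac' StronglyMeasurable.of_discrete (by simp)

/-- A finite strict order can be listed in an order-compatible way. -/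
theorem exists_list_pairwise_not {α : Type*} [Finite α] (r : α → α → Prop)
    (htrans : ∀ a b c, r a b → r b c → r a c) (hirr : ∀ a, ¬ r a a) :
    ∃ l : List α, (∀ a, a ∈ l) ∧ l.Pairwise fun a b => ¬ r b a := by
  classical
  have := Fintype.ofFinite α
  -- The number of predecessors increases strictly along `r`, so sorting by it suffices.
  let rank : α → ℕ := fun a => (Finset.univ.filter fun b => r b a).card
  have hrank : ∀ a b, r a b → rank a < rank b := by
    intro a b hab
    refine Finset.card_lt_card ⟨fun c hc => ?_, fun h => ?_⟩
    · simp only [Finset.mem_filter, Finset.mem_univ, true_and] at hc ⊢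
      exact htrans c a b hc hab
    · have := h (Finset.mem_filter.2 ⟨Finset.mem_univ a, hab⟩)
      simp only [Finset.mem_filter, Finset.mem_univ, true_and] at this
      exact hirr a this
  have : Std.Total fun a b : α => rank a ≤ rank b := ⟨fun a b => le_total _ _⟩
  have : IsTrans α fun a b : α => rank a ≤ rank b := ⟨fun a b c => le_trans⟩
  refine ⟨(Finset.univ : Finset α).toList.insertionSort fun a b => rank a ≤ rank b, fun a => ?_, ?_⟩
  · simp
  · refine (List.pairwise_insertionSort (fun a b => rank a ≤ rank b) _).imp fun hab hba => ?_
    exact (hrank _ _ hba).not_ge hab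

/-! ### Beliefs that justify undominated strategies -/

namespace ExtGame

variable {n : ℕ} {Γ : ExtGame n} {Ω : Type} [Finite Ω] [MeasurableSpace Ω]
  [DiscreteMeasurableSpace Ω] {s : Ω → Γ.Profile} {S : ∀ j, Set (Γ.Strat j)} {i : Fin n}
  {σ : Γ.Strat i} {U : Set Ω}

/-- A strategy that is not conditionally dominated is, at every information set, optimal against
some belief on the surviving strategies of the opponents. -/
theorem exists_optimal_belief (hσ : ∀ ω ∈ U, s ω i = σ)
    (hS : ∀ ω ∈ U, ∀ j, j ≠ i → s ω j ∈ S j)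
    (hU : ∀ τ : Γ.Profile, τ i = σ → (∀ j, j ≠ i → τ j ∈ S j) → ∃ ω ∈ U, s ω = τ)
    (hdom : ¬ Γ.CondDominated S i σ) {I : Γ.Info i} (hI : ∃ ω ∈ U, Γ.Reaches i (s ω) I) :
    ∃ ν : Measure Ω, IsProbabilityMeasure ν ∧ ν {ω | ω ∈ U ∧ Γ.Reaches i (s ω) I}ᶜ = 0 ∧
      ∀ σ' : Γ.Strat i, (∀ J, Γ.InfoPrecedes i J I → σ' J = σ J) →
        ∫ ω, Γ.payoff i (Function.update (s ω) i σ') ∂ν ≤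
          ∫ ω, Γ.payoff i (Function.update (s ω) i σ) ∂ν := by
  have hupd : ∀ ω ∈ U, Function.update (s ω) i σ = s ω := fun ω hω => by
    rw [← hσ ω hω, Function.update_eq_self]
  let X := {ω // ω ∈ U ∧ Γ.Reaches i (s ω) I}
  have : Fintype X := Fintype.ofFinite X
  -- Rows are the strategies that agree with `σ` before `I`, columns the states in `U` that reach
  -- `I`, and entries the gain over `σ`. A mixture of rows positive in every column would dominate
  -- `σ` conditionally.
  obtain ⟨p, hp, hle⟩ := exists_mem_stdSimplex_sum_nonpos
    (fun (ρ : Γ.Strat i) (x : X) => Γ.payoff i (Function.update (s x) i ρ) -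
      Γ.payoff i (Function.update (s x) i σ))
    (S := {ρ | ∀ J, Γ.InfoPrecedes i J I → ρ J = σ J}) ⟨σ, fun _ _ => rfl⟩ (by
      rintro ⟨w, hw, hpre, hpos⟩
      refine hdom ⟨I, w, hw, ?_, fun τ hτ => ?_⟩
      · obtain ⟨ω, hω, hr⟩ := hI
        refine ⟨s ω, (mem_condOpp_iff hpre).2 ⟨hS ω hω, ?_⟩⟩
        rwa [hupd ω hω]
      · obtain ⟨h1, h2⟩ := (mem_condOpp_iff hpre).1 hτ
        obtain ⟨ω, hω, hωτ⟩ := hU (Function.update τ i σ) (by simp) fun j hj => by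
          simpa [Function.update_of_ne hj] using h1 j hj
        have h3 := hpos ⟨ω, hω, hωτ ▸ h2⟩
        simp only [hωτ, Function.update_idem, mul_sub, Finset.sum_sub_distrib, ← Finset.sum_mul,
          hw.2, one_mul, sub_pos] at h3
        exact h3)
  obtain ⟨ν, hν, hnull, _, hint⟩ := exists_measure_of_mem_stdSimplex (fun x : X => (x : Ω)) hp
  refine ⟨ν, hν, ?_, fun σ' h' => ?_⟩
  · rwa [Subtype.range_coe_subtype] at hnull
  · have h1 := hle σ' h'
    simp only [mul_sub, Finset.sum_sub_distrib, sub_nonpos] at h1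
    rwa [hint, hint]

/-- A strategy that is optimal from `J` on is optimal conditional on reaching an information set
`I` that comes after `J`. -/
theorem setIntegral_payoff_le (hΓ : Γ.PerfectRecall) (hσ : ∀ ω ∈ U, s ω i = σ) {ν : Measure Ω}
    [IsFiniteMeasure ν] (hν : ν Uᶜ = 0) {I J : Γ.Info i} (hJI : J = I ∨ Γ.InfoPrecedes i J I)
    (hbest : ∀ σ' : Γ.Strat i, (∀ K, Γ.InfoPrecedes i K J → σ' K = σ K) →
      ∫ ω, Γ.payoff i (Function.update (s ω) i σ') ∂ν ≤
        ∫ ω, Γ.payoff i (Function.update (s ω) i σ) ∂ν)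
    {σ' : Γ.Strat i} (h' : ∀ K, Γ.InfoPrecedes i K I → σ' K = σ K) :
    ∫ ω in {ω | Γ.Reaches i (s ω) I}, Γ.payoff i (Function.update (s ω) i σ') ∂ν ≤
      ∫ ω in {ω | Γ.Reaches i (s ω) I}, Γ.payoff i (Function.update (s ω) i σ) ∂ν := by
  -- The graft is an admissible deviation at `J` and changes the payoff only where `I` is reached,
  -- so the comparison of full integrals reduces to the one over that event.
  have hle := hbest (graft I σ σ') fun K hK => graft_eq_of_infoPrecedes h' <| by
    rcases hJI with rfl | hJI
    · exact hK
    · exact hK.trans hΓ hJI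
  rw [← sub_nonpos, ← integral_sub .of_finite .of_finite] at hle ⊢
  refine le_of_eq_of_le ?_ hle
  rw [← integral_indicator MeasurableSet.of_discrete]
  refine integral_congr_ae ?_
  filter_upwards [show ∀ᵐ ω ∂ν, ω ∈ U from hν] with ω hω
  have hupd : Function.update (s ω) i σ = s ω := by
    rw [← hσ ω hω, Function.update_eq_self]
  by_cases hr : Γ.Reaches i (s ω) I
  · rw [Set.indicator_of_mem (show ω ∈ {ω | Γ.Reaches i (s ω) I} from hr),
      payoff_graft_of_reaches h' (hupd.symm ▸ hr)]
  · rw [Set.indicator_of_notMem (show ω ∉ {ω | Γ.Reaches i (s ω) I} from hr),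
      payoff_graft_of_not_reaches hΓ (hupd.symm ▸ hr), sub_self]

open Classical in
/-- For a set `U` of states at which a player plays `σ` and her opponents play all the surviving
profiles, there is a sequence of beliefs with support `U` against which `σ`, if it is not
conditionally dominated, is sequentially optimal. -/
theorem exists_beliefs (hΓ : Γ.PerfectRecall) (hσ : ∀ ω ∈ U, s ω i = σ)
    (hS : ∀ ω ∈ U, ∀ j, j ≠ i → s ω j ∈ S j)
    (hU : ∀ τ : Γ.Profile, τ i = σ → (∀ j, j ≠ i → τ j ∈ S j) → ∃ ω ∈ U, s ω = τ)
    (hne : U.Nonempty) :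
    ∃ l : List (Measure Ω), (∀ ν ∈ l, IsProbabilityMeasure ν) ∧ (∀ ν ∈ l, ν Uᶜ = 0) ∧
      (∃ ν ∈ l, ∀ ω ∈ U, ν {ω} ≠ 0) ∧
      (¬ Γ.CondDominated S i σ → ∀ (I : Γ.Info i) (ν : Measure Ω) (l' : List (Measure Ω)),
        l.filter (fun ν => ν {ω | Γ.Reaches i (s ω) I} ≠ 0) = ν :: l' →
        ∀ σ' : Γ.Strat i, (∀ J, Γ.InfoPrecedes i J I → σ' J = σ J) →
          ∫ ω in {ω | Γ.Reaches i (s ω) I}, Γ.payoff i (Function.update (s ω) i σ') ∂ν ≤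
            ∫ ω in {ω | Γ.Reaches i (s ω) I}, Γ.payoff i (Function.update (s ω) i σ) ∂ν) := by
  obtain ⟨ν₀, hν₀, hnull₀, hfull₀⟩ : ∃ ν : Measure Ω, IsProbabilityMeasure ν ∧ ν Uᶜ = 0 ∧
      ∀ ω ∈ U, ν {ω} ≠ 0 := by
    have : Fintype U := Fintype.ofFinite U
    have : Nonempty U := hne.to_subtype
    have hcard : (Fintype.card U : ℝ) ≠ 0 := Nat.cast_ne_zero.2 Fintype.card_ne_zero
    obtain ⟨ν, hν, hnull, hfull, _⟩ := exists_measure_of_mem_stdSimplex (fun x : U => (x : Ω))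
      (p := fun _ => (Fintype.card U : ℝ)⁻¹) ⟨fun _ => by positivity, by
        rw [Finset.sum_const, Finset.card_univ, nsmul_eq_mul, mul_inv_cancel₀ hcard]⟩
    refine ⟨ν, hν, by simpa using hnull, fun ω hω => hfull ⟨ω, hω⟩ (inv_ne_zero hcard)⟩
  by_cases hdom : Γ.CondDominated S i σ
  · exact ⟨[ν₀], by simpa using hν₀, by simpa using hnull₀, ⟨ν₀, by simp, hfull₀⟩,
      fun h => absurd hdom h⟩
  have hex : ∀ I : Γ.Info i, ∃ ν : Measure Ω, (∃ ω ∈ U, Γ.Reaches i (s ω) I) →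
      IsProbabilityMeasure ν ∧ ν {ω | ω ∈ U ∧ Γ.Reaches i (s ω) I}ᶜ = 0 ∧
      ∀ σ' : Γ.Strat i, (∀ J, Γ.InfoPrecedes i J I → σ' J = σ J) →
        ∫ ω, Γ.payoff i (Function.update (s ω) i σ') ∂ν ≤
          ∫ ω, Γ.payoff i (Function.update (s ω) i σ) ∂ν := by
    intro I
    by_cases hI : ∃ ω ∈ U, Γ.Reaches i (s ω) I
    · obtain ⟨ν, hν⟩ := exists_optimal_belief hσ hS hU hdom hI
      exact ⟨ν, fun _ => hν⟩
    · exact ⟨0, fun h => absurd h hI⟩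
  choose μ hμ using hex
  have hμU : ∀ I : Γ.Info i, (∃ ω ∈ U, Γ.Reaches i (s ω) I) → μ I Uᶜ = 0 := fun I hI =>
    measure_mono_null (Set.compl_subset_compl.2 fun ω hω => hω.1) (hμ I hI).2.1
  obtain ⟨L, hL, hpair⟩ := exists_list_pairwise_not (Γ.InfoPrecedes i)
    (fun _ _ _ h h' => h.trans hΓ h') (not_infoPrecedes_self hΓ)
  let L' := L.filter fun I => ∃ ω ∈ U, Γ.Reaches i (s ω) I
  have hL' : ∀ I, I ∈ L' ↔ ∃ ω ∈ U, Γ.Reaches i (s ω) I := fun I => by simp [L', hL]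
  -- Measures for earlier information sets come first; `ν₀` at the end charges every state of `U`.
  refine ⟨L'.map μ ++ [ν₀], fun ν hν => ?_, fun ν hν => ?_, ⟨ν₀, by simp, hfull₀⟩, ?_⟩
  · simp only [List.mem_append, List.mem_map, List.mem_singleton] at hν
    rcases hν with ⟨I, hI, rfl⟩ | rfl
    · exact (hμ I ((hL' I).1 hI)).1
    · exact hν₀
  · simp only [List.mem_append, List.mem_map, List.mem_singleton] at hν
    rcases hν with ⟨I, hI, rfl⟩ | rfl
    · exact hμU I ((hL' I).1 hI)
    · exact hnull₀
  intro _ I ν l' hl σ' h'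
  have hreach : ∀ ρ : Measure Ω, ρ Uᶜ = 0 → ρ {ω | Γ.Reaches i (s ω) I} ≠ 0 →
      ∃ ω ∈ U, Γ.Reaches i (s ω) I := by
    intro ρ hρ hne
    rw [← measure_inter_conull hρ] at hne
    obtain ⟨ω, hω, hω'⟩ := nonempty_of_measure_ne_zero hne
    exact ⟨ω, hω', hω⟩
  have hν : ν ∈ L'.map μ ++ [ν₀] ∧ ν {ω | Γ.Reaches i (s ω) I} ≠ 0 := by
    have : ν ∈ ν :: l' := List.mem_cons_self
    rw [← hl, List.mem_filter] at this
    simpa using this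
  have hI : ∃ ω ∈ U, Γ.Reaches i (s ω) I := by
    obtain ⟨h1, h2⟩ := hν
    simp only [List.mem_append, List.mem_map, List.mem_singleton] at h1
    rcases h1 with ⟨J, hJ, rfl⟩ | rfl
    · exact hreach _ (hμU J ((hL' J).1 hJ)) h2
    · exact hreach _ hnull₀ h2
  have hpos : ∀ J, (∃ ω ∈ U, Γ.Reaches i (s ω) J) → μ J {ω | Γ.Reaches i (s ω) J} ≠ 0 := by
    intro J hJ h0
    have := (hμ J hJ).1
    have h1 : μ J (Set.univ : Set Ω) = 0 := by
      rw [← measure_inter_conull (hμ J hJ).2.1]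
      exact measure_mono_null (fun ω hω => hω.2.2) h0
    simp at h1
  rw [List.filter_append, List.filter_map] at hl
  rcases hF : L'.filter ((fun ν : Measure Ω => decide (ν {ω | Γ.Reaches i (s ω) I} ≠ 0)) ∘ μ)
    with _ | ⟨J, L''⟩
  · have : I ∈ L'.filter
        ((fun ν : Measure Ω => decide (ν {ω | Γ.Reaches i (s ω) I} ≠ 0)) ∘ μ) := by
      rw [List.mem_filter]
      exact ⟨(hL' I).2 hI, by simpa using hpos I hI⟩
    rw [hF] at this
    simp at this
  · rw [hF, List.map_cons, List.cons_append] at hl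
    obtain ⟨rfl, _⟩ := List.cons.inj hl
    have hIm : I ∈ J :: L'' := by
      rw [← hF, List.mem_filter]
      exact ⟨(hL' I).2 hI, by simpa using hpos I hI⟩
    have hJm : J ∈ L' := by
      have : J ∈ J :: L'' := List.mem_cons_self
      rw [← hF] at this
      exact (List.mem_filter.1 this).1
    have hJ := (hL' J).1 hJm
    have hpair' : (J :: L'').Pairwise fun a b => ¬ Γ.InfoPrecedes i b a := by
      rw [← hF]
      exact (hpair.filter _).filter _
    -- `J` belongs to the first measure in the list that charges reaching `I`. Since `μ I` does so
    -- too, `J` is `I` or is listed before it.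
    have hIJ : ¬ Γ.InfoPrecedes i I J := by
      rcases List.mem_cons.1 hIm with rfl | h
      · exact not_infoPrecedes_self hΓ I
      · exact (List.pairwise_cons.1 hpair').1 I h
    have := (hμ J hJ).1
    refine setIntegral_payoff_le hΓ hσ (hμU J hJ) ?_ (hμ J hJ).2.2 h'
    have h2 := hν.2
    rw [← measure_inter_conull (hμ J hJ).2.1] at h2
    obtain ⟨ω, hω, _, hω'⟩ := nonempty_of_measure_ne_zero h2
    -- Some state charged by `μ J` has a path through both `I` and `J`, which makes them comparable.
    rcases infoPrecedes_trichotomy hω' hω with h | h | h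
    · exact Or.inr h
    · exact Or.inl h
    · exact absurd h hIJ

/-! ### The last information set on a path -/

/-- The information set of player `i` that contains the node `v`, if she moves there. -/
def infoAt (i : Fin n) (v : Γ.Node) : Option (Γ.Info i) := Sum.elim (Γ.info i) (fun _ => none) v

theorem infoAt_eq_some {i : Fin n} {v : Γ.Node} {I : Γ.Info i} :
    infoAt i v = some I ↔ Γ.InInfo i I v := by
  rcases v with d | z
  · refine ⟨fun h => ⟨d, rfl, h⟩, ?_⟩
    rintro ⟨d', hd, h⟩
    obtain rfl := Sum.inl.inj hd
    exact h
  · refine ⟨fun h => by simp [infoAt] at h, ?_⟩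
    rintro ⟨d', hd, h⟩
    simp at hd

theorem infoAt_eq_none {i : Fin n} {v : Γ.Node} : infoAt i v = none ↔ ¬ Γ.MovesAt i v := by
  rw [Option.eq_none_iff_forall_ne_some]
  simp only [ne_eq, infoAt_eq_some, MovesAt, not_exists]

/-- The last information set of player `i` on the path of `s` up to time `m`. -/
def lastInfo (i : Fin n) (s : Γ.Profile) : ℕ → Option (Γ.Info i)
  | 0 => infoAt i Γ.root
  | m + 1 => (infoAt i (Γ.nodeAt s (m + 1))).or (lastInfo i s m)

theorem lastInfo_of_inInfo {i : Fin n} {s : Γ.Profile} {m : ℕ} {I : Γ.Info i}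
    (h : Γ.InInfo i I (Γ.nodeAt s m)) : lastInfo i s m = some I := by
  rw [← infoAt_eq_some] at h
  cases m with
  | zero => exact h
  | succ m => rw [lastInfo, h, Option.some_or]

theorem lastInfo_succ_of_not_movesAt {i : Fin n} {s : Γ.Profile} {m : ℕ}
    (h : ¬ Γ.MovesAt i (Γ.nodeAt s (m + 1))) : lastInfo i s (m + 1) = lastInfo i s m := by
  rw [lastInfo, infoAt_eq_none.2 h, Option.none_or]

theorem exists_of_lastInfo_eq_some {i : Fin n} {s : Γ.Profile} {m : ℕ} {I : Γ.Info i}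
    (h : lastInfo i s m = some I) : ∃ m' ≤ m, Γ.InInfo i I (Γ.nodeAt s m') := by
  induction m with
  | zero => exact ⟨0, le_rfl, infoAt_eq_some.1 h⟩
  | succ m ih =>
    by_cases hm : Γ.MovesAt i (Γ.nodeAt s (m + 1))
    · obtain ⟨J, hJ⟩ := hm
      obtain rfl := Option.some.inj ((lastInfo_of_inInfo hJ).symm.trans h)
      exact ⟨m + 1, le_rfl, hJ⟩
    · rw [lastInfo_succ_of_not_movesAt hm] at h
      obtain ⟨m', hm', hI⟩ := ih h
      exact ⟨m', by omega, hI⟩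

/-- If player `i` has not moved up to time `m`, she does not move at the root, which is common to
all profiles. -/
theorem lastInfo_zero_of_eq_none {i : Fin n} {s s' : Γ.Profile} {m : ℕ}
    (h : lastInfo i s m = none) : lastInfo i s' 0 = none := by
  induction m with
  | zero => exact h
  | succ m ih =>
    rw [lastInfo, Option.or_eq_none_iff] at h
    exact ih h.2

section

variable {Ω : Type} (s : Ω → Γ.Profile) (i : Fin n)

/-- The states at which the path goes through the information set `o` (all states if there is
none). -/
def passes : Option (Γ.Info i) → Set Ω
  | none => Set.univ
  | some I => {ω | Γ.Reaches i (s ω) I}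

/-- The time at which the path goes through the information set `o` (time `0` if there is none). -/
noncomputable def passTime : Option (Γ.Info i) → Ω → ℕ
  | none, _ => 0
  | some I, ω => sInf {m | Γ.InInfo i I (Γ.nodeAt (s ω) m)}

variable {s i}

theorem inInfo_passTime {I : Γ.Info i} {ω : Ω} (h : ω ∈ passes s i (some I)) :
    Γ.InInfo i I (Γ.nodeAt (s ω) (passTime s i (some I) ω)) :=
  Nat.sInf_mem (s := {m | Γ.InInfo i I (Γ.nodeAt (s ω) m)}) h

theorem mem_passes_lastInfo {ω : Ω} {s₀ : Γ.Profile} (h : s ω = s₀) (m : ℕ) :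
    ω ∈ passes s i (lastInfo i s₀ m) := by
  rcases hl : lastInfo i s₀ m with _ | I
  · trivial
  · obtain ⟨m', _, hm'⟩ := exists_of_lastInfo_eq_some hl
    exact ⟨m', h ▸ hm'⟩

/-- The reason for introspection: beliefs will depend on the time only through the last information
set, and this set is the same at the time where each state is placed. -/
theorem lastInfo_passTime {s₀ : Γ.Profile} {m : ℕ} {ω : Ω}
    (h : ω ∈ passes s i (lastInfo i s₀ m)) :
    lastInfo i (s ω) (passTime s i (lastInfo i s₀ m) ω) = lastInfo i s₀ m := by
  rcases hl : lastInfo i s₀ m with _ | I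
  · exact lastInfo_zero_of_eq_none hl
  · rw [hl] at h
    exact lastInfo_of_inInfo (inInfo_passTime h)

theorem passTime_lastInfo_zero {s₀ : Γ.Profile} {ω : Ω} :
    passTime s i (lastInfo i s₀ 0) ω = 0 := by
  rcases hl : lastInfo i s₀ 0 with _ | I
  · rfl
  · exact Nat.sInf_eq_zero.2 (Or.inl (infoAt_eq_some.1 hl))

theorem mem_passes_lastInfo_zero {s₀ : Γ.Profile} {ω : Ω} :
    ω ∈ passes s i (lastInfo i s₀ 0) :=
  mem_passes_lastInfo (m := 0) (s₀ := s ω) rfl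

/-- Perfect recall makes the successive conditioning events decrease. Hence supports shrink over
time, and conditioning step by step equals conditioning the initial beliefs once. -/
theorem passes_lastInfo_succ_subset (hΓ : Γ.PerfectRecall) (s₀ : Γ.Profile) (m : ℕ) :
    passes s i (lastInfo i s₀ (m + 1)) ⊆ passes s i (lastInfo i s₀ m) := by
  by_cases hm : Γ.MovesAt i (Γ.nodeAt s₀ (m + 1))
  · obtain ⟨J, hJ⟩ := hm
    rw [lastInfo_of_inInfo hJ]
    rcases hl : lastInfo i s₀ m with _ | I
    · exact Set.subset_univ _
    · obtain ⟨m', hm', hI⟩ := exists_of_lastInfo_eq_some hl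
      exact fun ω hω => (infoPrecedes_of_lt hI hJ (by omega)).reaches hΓ hω
  · rw [lastInfo_succ_of_not_movesAt hm]

end

end ExtGame

/-! ### Conditioning of sequences -/

section

variable {X : Type} [MeasurableSpace X]

theorem mem_condList {l : List (Measure X)} {A : Set X} {μ : Measure X} :
    μ ∈ condList l A ↔ ∃ ν ∈ l, ν A ≠ 0 ∧ ProbabilityTheory.cond ν A = μ := by
  simp [condList, and_assoc]

theorem condList_condList [DiscreteMeasurableSpace X] {l : List (Measure X)}
    (hl : ∀ ν ∈ l, IsProbabilityMeasure ν) {A B : Set X} (h : B ⊆ A) : condList (condList l A) B = condList l B := by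
  classical
  induction l with
  | nil => rfl
  | cons ν l ih =>
    have := hl ν List.mem_cons_self
    have hcond : ProbabilityTheory.cond (ProbabilityTheory.cond ν A) B =
        ProbabilityTheory.cond ν B := by
      rw [ProbabilityTheory.cond_cond_eq_cond_inter .of_discrete .of_discrete,
        Set.inter_eq_self_of_subset_right h]
    have hcons : ∀ (ρ : Measure X) (l' : List (Measure X)) (C : Set X), condList (ρ :: l') C =
        if ρ C ≠ 0 then ProbabilityTheory.cond ρ C :: condList l' C else condList l' C := by
      intro ρ l' C
      by_cases hC : ρ C = 0 <;> simp [condList, hC]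
    have ih' := ih fun ρ hρ => hl ρ (List.mem_cons_of_mem ν hρ)
    have hB : ProbabilityTheory.cond ν A B = (ν A)⁻¹ * ν B := by
      rw [ProbabilityTheory.cond_apply .of_discrete, Set.inter_eq_self_of_subset_right h]
    by_cases hA : ν A = 0
    · have hB0 : ν B = 0 := measure_mono_null h hA
      rw [hcons ν l A, if_neg (by simpa using hA), hcons ν l B, if_neg (by simpa using hB0), ih']
    · rw [hcons ν l A, if_pos hA, hcons, hcons ν l B, hcond, ih', hB]
      have : (ν A)⁻¹ * ν B ≠ 0 ↔ ν B ≠ 0 := by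
        simp [measure_ne_top]
      simp only [this]

end

/-! ### Structures generated by initial beliefs -/

/-- Initial beliefs of the players about the state: `supp i ω` is the set of the states that player
`i` considers possible at `ω`. -/
structure PriorBeliefs {n : ℕ} (Γ : ExtGame n) {Ω : Type} [MeasurableSpace Ω]
    (s : Ω → Γ.Profile) where
  supp : Fin n → Ω → Set Ω
  beliefs : Fin n → Ω → List (Measure Ω)
  beliefs_eq : ∀ i ω, ∀ ω' ∈ supp i ω, beliefs i ω' = beliefs i ω
  strat_eq : ∀ i ω, ∀ ω' ∈ supp i ω, s ω' i = s ω i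
  -- The state `ω` itself may be considered impossible; it is enough that its profile is not, so
  -- that conditioning along the actual path never leaves an empty sequence.
  exists_mem : ∀ i ω, ∃ ω' ∈ supp i ω, s ω' = s ω
  prob : ∀ i ω, ∀ ν ∈ beliefs i ω, IsProbabilityMeasure ν
  null : ∀ i ω, ∀ ν ∈ beliefs i ω, ν (supp i ω)ᶜ = 0
  full : ∀ i ω, ∃ ν ∈ beliefs i ω, ∀ ω' ∈ supp i ω, ν {ω'} ≠ 0

namespace PriorBeliefs

open ExtGame

variable {n : ℕ} {Γ : ExtGame n} {Ω : Type} [MeasurableSpace Ω]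

/-- The measure on pairs of a state and a time that puts each state at the time at which its path
goes through `o`. -/
noncomputable def atPassTime (s : Ω → Γ.Profile) (i : Fin n) (o : Option (Γ.Info i))
    (ν : Measure Ω) : @Measure (Ω × ℕ) ⊤ :=
  @Measure.map Ω (Ω × ℕ) _ ⊤ (fun ω => (ω, passTime s i o ω)) ν


variable {s : Ω → Γ.Profile} (P : PriorBeliefs Γ s)

/-- The beliefs of player `i` when her last information set is `o`. -/
noncomputable def beliefList (i : Fin n) (ω : Ω) (o : Option (Γ.Info i)) :
    List (@Measure (Ω × ℕ) ⊤) :=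
  (condList (P.beliefs i ω) (passes s i o)).map (atPassTime s i o)

theorem mem_beliefList {i : Fin n} {ω : Ω} {o : Option (Γ.Info i)} {μ : @Measure (Ω × ℕ) ⊤} :
    μ ∈ P.beliefList i ω o ↔ ∃ ν ∈ P.beliefs i ω, ν (passes s i o) ≠ 0 ∧
      atPassTime s i o (ProbabilityTheory.cond ν (passes s i o)) = μ := by
  simp only [beliefList, List.mem_map, mem_condList]
  constructor
  · rintro ⟨_, ⟨ν, hν, h0, rfl⟩, rfl⟩
    exact ⟨ν, hν, h0, rfl⟩
  · rintro ⟨ν, hν, h0, rfl⟩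
    exact ⟨_, ⟨ν, hν, h0, rfl⟩, rfl⟩

variable [DiscreteMeasurableSpace Ω]

theorem atPassTime_apply {i : Fin n} {o : Option (Γ.Info i)} {ν : Measure Ω} (A : Set (Ω × ℕ)) :
    atPassTime s i o ν A = ν {ω | (ω, passTime s i o ω) ∈ A} :=
  @Measure.map_apply Ω (Ω × ℕ) _ ⊤ ν _ (fun _ _ => MeasurableSet.of_discrete) A trivial

/-- The beliefs of player `i` at `(ω, m)`: her initial beliefs, conditioned on the last information
set she has reached. -/
noncomputable def PR (i : Fin n) (ω : Ω) (m : ℕ) : LPS (Ω × ℕ) ⊤ where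
  toList := P.beliefList i ω (lastInfo i (s ω) m)
  ne_nil := by
    obtain ⟨ν, hν, hfull⟩ := P.full i ω
    obtain ⟨ω', hω', hs⟩ := P.exists_mem i ω
    refine List.ne_nil_of_mem (P.mem_beliefList.2 ⟨ν, hν, fun h0 => hfull ω' hω' ?_, rfl⟩)
    exact measure_mono_null (Set.singleton_subset_iff.2 (mem_passes_lastInfo hs m)) h0
  prob := by
    intro μ hμ
    obtain ⟨ν, hν, h0, rfl⟩ := P.mem_beliefList.1 hμ
    have := P.prob i ω ν hν
    have := ProbabilityTheory.cond_isProbabilityMeasure h0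
    refine ⟨?_⟩
    rw [atPassTime_apply]
    simp

/-- The structure in which the players condition their initial beliefs on the information sets they
reach. -/
noncomputable abbrev toStruct : EpStruct Γ where
  Ω := Ω
  strat := s
  F := ⊤
  PR := P.PR

theorem PR_certain {i : Fin n} {ω : Ω} {m : ℕ} {A : Set (Ω × ℕ)}
    (h : ∀ ω' ∈ P.supp i ω, ω' ∈ passes s i (lastInfo i (s ω) m) →
      (ω', passTime s i (lastInfo i (s ω) m) ω') ∈ A) : (P.PR i ω m).Certain A := by
  refine ⟨A, trivial, subset_rfl, fun μ hμ => ?_⟩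
  obtain ⟨ν, hν, h0, rfl⟩ := P.mem_beliefList.1 hμ
  have := P.prob i ω ν hν
  have := ProbabilityTheory.cond_isProbabilityMeasure h0
  rw [atPassTime_apply, ← prob_compl_eq_zero_iff .of_discrete,
    ProbabilityTheory.cond_apply .of_discrete]
  refine mul_eq_zero_of_right _ (measure_mono_null ?_ (P.null i ω ν hν))
  rintro ω' ⟨h1, h2⟩ h3
  exact h2 (h ω' h3 h1)

theorem PR_possible_iff {i : Fin n} {ω : Ω} {m : ℕ} {A : Set (Ω × ℕ)} :
    (P.PR i ω m).Possible A ↔ ∃ ν ∈ P.beliefs i ω, ν (passes s i (lastInfo i (s ω) m) ∩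
      {ω' | (ω', passTime s i (lastInfo i (s ω) m) ω') ∈ A}) ≠ 0 := by
  constructor
  · rintro ⟨E, _, hEA, μ, hμ, hne⟩
    obtain ⟨ν, hν, h0, rfl⟩ := P.mem_beliefList.1 hμ
    refine ⟨ν, hν, fun h => hne ?_⟩
    rw [atPassTime_apply, ProbabilityTheory.cond_apply .of_discrete]
    refine mul_eq_zero_of_right _ (measure_mono_null ?_ h)
    exact Set.inter_subset_inter_right _ fun ω' hω' => hEA hω'
  · rintro ⟨ν, hν, hne⟩
    have := P.prob i ω ν hν
    have h0 : ν (passes s i (lastInfo i (s ω) m)) ≠ 0 := fun h0 =>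
      hne (measure_mono_null Set.inter_subset_left h0)
    refine ⟨A, trivial, subset_rfl, _, P.mem_beliefList.2 ⟨ν, hν, h0, rfl⟩, ?_⟩
    rw [atPassTime_apply, ProbabilityTheory.cond_apply .of_discrete]
    exact mul_ne_zero (by simp [measure_ne_top]) hne

theorem PR_zero_possible {i : Fin n} {ω ω' : Ω} (hω' : ω' ∈ P.supp i ω) {A : Set (Ω × ℕ)}
    (h : (ω', 0) ∈ A) : (P.PR i ω 0).Possible A := by
  obtain ⟨ν, hν, hfull⟩ := P.full i ω
  refine P.PR_possible_iff.2 ⟨ν, hν, fun h0 => hfull ω' hω' (measure_mono_null ?_ h0)⟩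
  rw [Set.singleton_subset_iff]
  refine ⟨mem_passes_lastInfo_zero, ?_⟩
  change (ω', passTime s i (lastInfo i (s ω) 0) ω') ∈ A
  rwa [passTime_lastInfo_zero]

theorem PR_zero_certain {i : Fin n} {ω : Ω} {A : Set (Ω × ℕ)}
    (h : ∀ ω' ∈ P.supp i ω, (ω', 0) ∈ A) : (P.PR i ω 0).Certain A :=
  P.PR_certain fun ω' hω' _ => by
    rw [passTime_lastInfo_zero]
    exact h ω' hω'

theorem PR_congr {i : Fin n} {ω ω' : Ω} {m m' : ℕ} (h : P.beliefs i ω' = P.beliefs i ω)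
    (h' : lastInfo i (s ω') m' = lastInfo i (s ω) m) : P.PR i ω' m' = P.PR i ω m := by
  refine LPS.ext ?_
  change P.beliefList i ω' (lastInfo i (s ω') m') = P.beliefList i ω (lastInfo i (s ω) m)
  rw [beliefList, beliefList, h, h']

theorem appropriate (hΓ : Γ.PerfectRecall) : P.toStruct.Appropriate where
  strat_measurable _ _ := trivial
  knows_strat i ω _ := P.PR_certain fun ω' hω' _ => P.strat_eq i ω ω' hω'
  belief_measurable _ _ := trivial
  knows_belief i ω _ := P.PR_certain fun ω' hω' hp =>
    P.PR_congr (P.beliefs_eq i ω ω' hω') (lastInfo_passTime hp)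
  knows_info i ω m I hI := P.PR_certain fun ω' _ hp => by
    rw [lastInfo_of_inInfo hI] at hp ⊢
    exact inInfo_passTime hp
  knows_start _ _ := P.PR_certain fun _ _ _ => passTime_lastInfo_zero
  support_mono i ω m τ h := by
    obtain ⟨ν, hν, hne⟩ := P.PR_possible_iff.1 h
    refine P.PR_possible_iff.2 ⟨ν, hν, fun h0 => hne (measure_mono_null ?_ h0)⟩
    exact Set.inter_subset_inter_left _ (passes_lastInfo_succ_subset hΓ (s ω) m)

theorem l1Measurable : P.toStruct.L1Measurable := fun _ _ => trivial

theorem respectsConditioning (hΓ : Γ.PerfectRecall)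
    (hΩ : ‹MeasurableSpace Ω› = (⊤ : MeasurableSpace (Ω × ℕ)).map Prod.fst) :
    P.toStruct.RespectsConditioning := by
  subst hΩ
  let _ : MeasurableSpace Ω := (⊤ : MeasurableSpace (Ω × ℕ)).map Prod.fst
  have hproj : ∀ i ω m, P.toStruct.proj i ω m =
      condList (P.beliefs i ω) (passes s i (lastInfo i (s ω) m)) := by
    intro i ω m
    change ((condList (P.beliefs i ω) (passes s i (lastInfo i (s ω) m))).map
      (atPassTime s i (lastInfo i (s ω) m))).map _ = _
    rw [List.map_map]
    refine List.map_id'' (fun ν => ?_) _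
    refine Measure.ext fun A _ => ?_
    refine (@Measure.map_apply (Ω × ℕ) Ω ⊤ _ _ Prod.fst (fun _ _ => trivial) A
      MeasurableSet.of_discrete).trans ?_
    exact atPassTime_apply _
  intro i ω m
  refine ⟨fun h => P.PR_congr rfl (lastInfo_succ_of_not_movesAt h), fun I hI => ?_⟩
  have hsub := passes_lastInfo_succ_subset (s := s) (i := i) hΓ (s ω) m
  rw [hproj, hproj]
  rw [lastInfo_of_inInfo hI] at hsub ⊢
  exact (condList_condList (P.prob i ω) hsub).symm

-- The first measure of the belief at `I` comes from the first initial measure that charges reaching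
-- `I`. Expectations under it are a nonnegative multiple of the set integrals in `h`.
open Classical in
theorem rational {i : Fin n} {ω : Ω}
    (h : ∀ (I : Γ.Info i) (ν : Measure Ω) (l : List (Measure Ω)),
      (P.beliefs i ω).filter (fun ν => ν {ω | Γ.Reaches i (s ω) I} ≠ 0) = ν :: l →
      ∀ σ' : Γ.Strat i, (∀ J, Γ.InfoPrecedes i J I → σ' J = s ω i J) →
        ∫ ω' in {ω | Γ.Reaches i (s ω) I}, Γ.payoff i (Function.update (s ω') i σ') ∂ν ≤
          ∫ ω' in {ω | Γ.Reaches i (s ω) I}, Γ.payoff i (Function.update (s ω') i (s ω i)) ∂ν)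
    (m : ℕ) : P.toStruct.Rational i ω m := by
  intro I hI σ' hσ'
  have hlast : lastInfo i (s ω) m = some I := lastInfo_of_inInfo hI
  have htop : (P.PR i ω m).top ∈ (P.PR i ω m).toList := List.head_mem _
  obtain ⟨ν, l, hl, hν⟩ : ∃ ν l,
      (P.beliefs i ω).filter (fun ν => ν {ω | Γ.Reaches i (s ω) I} ≠ 0) = ν :: l ∧
      (P.PR i ω m).top = atPassTime s i (some I)
        (ProbabilityTheory.cond ν {ω | Γ.Reaches i (s ω) I}) := by
    have hlist : (P.PR i ω m).toList =
        (((P.beliefs i ω).filter (fun ν => ν {ω | Γ.Reaches i (s ω) I} ≠ 0)).map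
          (fun ν => ProbabilityTheory.cond ν {ω | Γ.Reaches i (s ω) I})).map
            (atPassTime s i (some I)) := by
      change P.beliefList i ω (lastInfo i (s ω) m) = _
      rw [hlast]
      rfl
    rcases hf : (P.beliefs i ω).filter (fun ν => ν {ω | Γ.Reaches i (s ω) I} ≠ 0) with _ | ⟨ν, l⟩
    · rw [hf] at hlist
      exact absurd hlist (P.PR i ω m).ne_nil
    · refine ⟨ν, l, hf, ?_⟩
      rw [hf] at hlist
      simp only [LPS.top, hlist, List.map_cons, List.head_cons]
  let _ : MeasurableSpace (Ω × ℕ) := ⊤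
  have := (P.PR i ω m).prob _ htop
  have hcert : ∀ᵐ x ∂(P.PR i ω m).top, x ∈ {x : Ω × ℕ |
      Γ.Reaches i (Function.update (s x.1) i (s ω i)) I} := by
    refine LPS.Certain.ae (P.PR_certain fun ω' hω' hp => ?_) htop
    rw [hlast] at hp
    change Γ.Reaches i (Function.update (s ω') i (s ω i)) I
    rw [← P.strat_eq i ω ω' hω', Function.update_eq_self]
    exact hp
  have hcond := ProbabilityTheory.cond_eq_self_of_ae_mem (by trivial) hcert
  have hint : ∀ f : Ω → ℝ, ∫ x, f x.1 ∂(P.PR i ω m).top =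
      ((ν {ω | Γ.Reaches i (s ω) I})⁻¹).toReal * ∫ ω' in {ω | Γ.Reaches i (s ω) I}, f ω' ∂ν := by
    intro f
    have hf : Measurable fun x : Ω × ℕ => f x.1 := fun _ _ => trivial
    rw [hν, atPassTime, integral_map (Measurable.of_discrete.aemeasurable)
      hf.aestronglyMeasurable, ProbabilityTheory.cond,
      integral_smul_measure, smul_eq_mul]
  change ∫ x : Ω × ℕ, Γ.payoff i (Function.update (s x.1) i σ') ∂(ProbabilityTheory.cond
      (P.PR i ω m).top {x | Γ.Reaches i (Function.update (s x.1) i (s ω i)) I}) ≤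
    ∫ x : Ω × ℕ, Γ.payoff i (Function.update (s x.1) i (s ω i)) ∂(ProbabilityTheory.cond
      (P.PR i ω m).top {x | Γ.Reaches i (Function.update (s x.1) i (s ω i)) I})
  rw [hcond, hint fun ω' => Γ.payoff i (Function.update (s ω') i σ'),
    hint fun ω' => Γ.payoff i (Function.update (s ω') i (s ω i))]
  exact mul_le_mul_of_nonneg_left (h I ν l hl σ' hσ') ENNReal.toReal_nonneg

end PriorBeliefs

/-! ### The canonical structures -/

namespace CanonState

open ExtGame

variable {n : ℕ} {Γ : ExtGame n} {k : ℕ}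

instance : Finite (CanonState Γ k) := by
  refine Finite.of_injective
    (fun p : CanonState Γ k => ((⟨p.1.1, Nat.lt_succ_of_le p.2.1⟩, p.1.2) :
      Fin (k + 1) × Fin n × Γ.Profile)) fun p q h => ?_
  simp only [Prod.mk.injEq, Fin.mk.injEq] at h
  exact Subtype.ext (Prod.ext h.1 h.2)

instance : MeasurableSpace (CanonState Γ k) :=
  (⊤ : MeasurableSpace (CanonState Γ k × ℕ)).map Prod.fst

instance : DiscreteMeasurableSpace (CanonState Γ k) := ⟨fun _ => trivial⟩

/-- The profile played at a state. -/
abbrev strat (p : CanonState Γ k) : Γ.Profile := p.1.2.2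

/-- The level of the states that player `i` considers possible at `p`. -/
def level (i : Fin n) (p : CanonState Γ k) : ℕ := if p.1.2.1 = i then p.1.1 else p.1.1 - 1

theorem level_le (i : Fin n) (p : CanonState Γ k) : level i p ≤ p.1.1 := by
  rw [level]
  split_ifs <;> omega

theorem strat_mem (p : CanonState Γ k) (i j : Fin n) : strat p j ∈ Γ.NCD (level i p) j :=
  NCD_anti (level_le i p) j (p.2.2 j)

/-- The states of level `l` with label `i` at which player `i` plays `σ`. -/
def support (k : ℕ) (i : Fin n) (l : ℕ) (σ : Γ.Strat i) : Set (CanonState Γ k) :=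
  {p | p.1.1 = l ∧ p.1.2.1 = i ∧ strat p i = σ}

theorem level_of_mem_support {i : Fin n} {l : ℕ} {σ : Γ.Strat i} {p : CanonState Γ k}
    (h : p ∈ support k i l σ) : level i p = l := by
  rw [level, if_pos h.2.1, h.1]

theorem exists_mem_support {i : Fin n} {l : ℕ} (hl : l ≤ k) {τ : Γ.Profile}
    (hτ : ∀ j, τ j ∈ Γ.NCD l j) : ∃ p ∈ support k i l (τ i), strat p = τ :=
  ⟨⟨(l, i, τ), hl, hτ⟩, ⟨rfl, rfl, rfl⟩, rfl⟩

open Classical in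
theorem exists_priorBeliefs (hΓ : Γ.PerfectRecall) (k : ℕ) :
    ∃ P : PriorBeliefs Γ (strat : CanonState Γ k → Γ.Profile),
      (∀ i p, P.supp i p = support k i (level i p) (strat p i)) ∧
      ∀ i p, ¬ Γ.CondDominated (Γ.NCD (level i p)) i (strat p i) →
        ∀ (I : Γ.Info i) (ν : Measure (CanonState Γ k)) (l : List (Measure (CanonState Γ k))),
          (P.beliefs i p).filter (fun ν => ν {ω | Γ.Reaches i (strat ω) I} ≠ 0) = ν :: l →
          ∀ σ' : Γ.Strat i, (∀ J, Γ.InfoPrecedes i J I → σ' J = strat p i J) →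
            ∫ ω in {ω | Γ.Reaches i (strat ω) I},
                Γ.payoff i (Function.update (strat ω) i σ') ∂ν ≤
              ∫ ω in {ω | Γ.Reaches i (strat ω) I},
                Γ.payoff i (Function.update (strat ω) i (strat p i)) ∂ν := by
  -- Beliefs are chosen once for each player, level and strategy and not for each state, which makes
  -- them constant on each support.
  have hex := fun (i : Fin n) (q : {q : ℕ × Γ.Strat i // q.1 ≤ k ∧ q.2 ∈ Γ.NCD q.1 i}) => by
    have h1 := fun (p : CanonState Γ k) (hp : p ∈ support k i q.1.1 q.1.2) => hp.2.2
    have h2 := fun (τ : Γ.Profile) (hτ : τ i = q.1.2)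
        (hτ' : ∀ j, j ≠ i → τ j ∈ Γ.NCD q.1.1 j) =>
      hτ ▸ exists_mem_support (k := k) (i := i) q.2.1 (τ := τ) fun j => by
        by_cases hj : j = i
        · subst hj
          exact hτ ▸ q.2.2
        · exact hτ' j hj
    refine exists_beliefs (S := Γ.NCD q.1.1) hΓ h1
      (fun p hp j _ => hp.1 ▸ p.2.2 j) h2 ?_
    choose τ hτ using exists_mem_NCD hΓ q.1.1
    obtain ⟨p, hp, _⟩ := h2 (Function.update τ i q.1.2) (by simp) fun j hj => by
      simpa [Function.update_of_ne hj] using hτ j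
    exact ⟨p, hp⟩
  choose β hprob hnull hfull hbest using hex
  let idx : ∀ (i : Fin n) (p : CanonState Γ k), {q : ℕ × Γ.Strat i // q.1 ≤ k ∧ q.2 ∈ Γ.NCD q.1 i} :=
    fun i p => ⟨(level i p, strat p i), (level_le i p).trans p.2.1, strat_mem p i i⟩
  refine ⟨{ supp := fun i p => support k i (level i p) (strat p i)
            beliefs := fun i p => β i (idx i p)
            beliefs_eq := fun i p p' hp' => ?_
            strat_eq := fun i p p' hp' => hp'.2.2
            exists_mem := fun i p =>
              exists_mem_support ((level_le i p).trans p.2.1) (strat_mem p i)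
            prob := fun i p => hprob i (idx i p)
            null := fun i p => hnull i (idx i p)
            full := fun i p => hfull i (idx i p) }, fun _ _ => rfl, fun i p => hbest i (idx i p)⟩
  congr 1
  exact Subtype.ext (Prod.ext (level_of_mem_support hp') hp'.2.2)

/-- The initial beliefs in the canonical structure. -/
noncomputable def prior (hΓ : Γ.PerfectRecall) (k : ℕ) :
    PriorBeliefs Γ (strat : CanonState Γ k → Γ.Profile) := (exists_priorBeliefs hΓ k).choose

theorem supp_prior (hΓ : Γ.PerfectRecall) (i : Fin n) (p : CanonState Γ k) :
    (prior hΓ k).supp i p = support k i (level i p) (strat p i) :=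
  (exists_priorBeliefs hΓ k).choose_spec.1 i p

theorem rational_prior (hΓ : Γ.PerfectRecall) {i : Fin n} {p : CanonState Γ k}
    (h : strat p i ∈ Γ.NCD (level i p + 1) i) (m : ℕ) :
    (prior hΓ k).toStruct.Rational i p m :=
  (prior hΓ k).rational ((exists_priorBeliefs hΓ k).choose_spec.2 i p h.2) m

end CanonState

/-! ### The simultaneous induction on the level -/

section

open CanonState ExtGame

/-- Level-`k` rationality implies that the strategy survives `k` rounds. -/
def RationalitySound {n : ℕ} (Γ : ExtGame n) (k : ℕ) : Prop :=
  ∀ (M : EpStruct Γ) (ω : M.Ω) (m : ℕ) (i : Fin n), M.Appropriate →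
    Sat (Form.RATEFR k i) M ω m → M.strat ω i ∈ Γ.NCD k i

/-- The formula for level-`k` rationality holds where it is meant to hold in the canonical
structures. -/
def CanonicallyRational {n : ℕ} {Γ : ExtGame n} (hΓ : Γ.PerfectRecall) (k : ℕ) : Prop :=
  ∀ (K : ℕ) (p : CanonState Γ K) (i : Fin n) (m : ℕ),
    (k = 0 ∨ level i p + 1 = k ∧ strat p i ∈ Γ.NCD k i) →
      Sat (Form.RATEFR k i) (prior hΓ K).toStruct p m

variable {n : ℕ} {Γ : ExtGame n} {hΓ : Γ.PerfectRecall} {k : ℕ}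

/-- A player other than the label has beliefs one level down, which is what rationality of the level
of `p` requires. -/
theorem CanonicallyRational.sat_others {K : ℕ} {p : CanonState Γ K}
    (h : CanonicallyRational hΓ p.1.1) (m : ℕ) :
    Sat (Form.others p.1.2.1 (Form.RATEFR p.1.1)) (prior hΓ K).toStruct p m := by
  refine Sat_others.2 fun j hj => h K p j m ?_
  by_cases h0 : p.1.1 = 0
  · exact Or.inl h0
  · refine Or.inr ⟨?_, p.2.2 j⟩
    rw [level, if_neg (Ne.symm hj)]
    omega

/-- The state used has label `i` and level `k - 1`, so that `i` has beliefs of level `k - 1`; for `k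
= 0` the formula is trivial. -/
theorem CanonicallyRational.exists_sat (h : CanonicallyRational hΓ k) {i : Fin n}
    {σ : Γ.Strat i} (hσ : σ ∈ Γ.NCD k i) :
    ∃ (M : EpStruct Γ) (ω : M.Ω) (m : ℕ), M.Appropriate ∧ M.L1Measurable ∧
      M.RespectsConditioning ∧ M.strat ω i = σ ∧ Sat (Form.RATEFR k i) M ω m := by
  choose τ hτ using exists_mem_NCD hΓ (k - 1)
  have hσ' : σ ∈ Γ.NCD (k - 1) i := NCD_anti (Nat.sub_le k 1) i hσ
  let p : CanonState Γ k := ⟨(k - 1, i, Function.update τ i σ), Nat.sub_le k 1, fun j => by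
    by_cases hj : j = i
    · subst hj
      simpa using hσ'
    · simpa [Function.update_of_ne hj] using hτ j⟩
  have hp : strat p i = σ := Function.update_self i σ τ
  refine ⟨(prior hΓ k).toStruct, p, 0, (prior hΓ k).appropriate hΓ, (prior hΓ k).l1Measurable,
    (prior hΓ k).respectsConditioning hΓ rfl, hp, h k p i 0 ?_⟩
  rcases Nat.eq_zero_or_pos k with h0 | h0
  · exact Or.inl h0
  · refine Or.inr ⟨?_, hp ▸ hσ⟩
    rw [level, if_pos rfl]
    exact Nat.sub_add_cancel h0

theorem CanonicallyRational.sound_succ (h : CanonicallyRational hΓ k)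
    (hs : RationalitySound Γ k) : RationalitySound Γ (k + 1) := by
  intro M ω m i hM hsat
  refine hM.mem_NCD_succ_of_sat hΓ hs (fun i τ hτ => ?_) hsat
  let p : CanonState Γ k := ⟨(k, i, τ), le_rfl, hτ⟩
  exact ⟨(prior hΓ k).toStruct, p, 0, (prior hΓ k).appropriate hΓ, sat_others (p := p) h 0, rfl⟩

theorem CanonicallyRational.succ (h : CanonicallyRational hΓ k) (hs : RationalitySound Γ k) :
    CanonicallyRational hΓ (k + 1) := by
  intro K p i m hp
  obtain ⟨hl, hσ⟩ := hp.resolve_left k.succ_ne_zero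
  obtain rfl : level i p = k := Nat.succ.inj hl
  have hsupp : ∀ p' ∈ (prior hΓ K).supp i p,
      p'.1.1 = level i p ∧ p'.1.2.1 = i ∧ strat p' i = strat p i := fun p' hp' => by
    rw [supp_prior] at hp'
    exact hp'
  refine ⟨(prior hΓ K).PR_zero_certain fun p' hp' => ?_, fun σ => ?_, ?_, fun ψ => ?_⟩
  · obtain ⟨h1, h2, h3⟩ := hsupp p' hp'
    intro m' _
    refine rational_prior hΓ ?_ m'
    rwa [h3, level, if_pos h2, h1]
  · refine Sat_imp.2 fun hplay => ?_
    obtain ⟨M, ω, m', hM, _, _, h1, h2⟩ := h.exists_sat hσ.1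
    exact ⟨M, ω, m', hM, h1.trans hplay, h2⟩
  · refine (prior hΓ K).PR_zero_certain fun p' hp' => ?_
    obtain ⟨h1, h2, _⟩ := hsupp p' hp'
    -- States in the support carry the label `i`, so all opponents of `i` are rational there to the
    -- level of the state.
    have h3 := sat_others (p := p') (h1.symm ▸ h) 0
    rwa [h1, h2] at h3
  · refine Sat_imp.2 ?_
    rintro ⟨M, ω, m', hM, hoth, hψ⟩
    -- Soundness at the lower level puts the opponents' strategies in `M` among the survivors, and
    -- the support contains every surviving opponents' profile together with the strategy of `i`.
    obtain ⟨p', hp', hs'⟩ := exists_mem_support (k := K) (i := i)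
      ((level_le i p).trans p.2.1) (τ := Function.update (M.strat ω) i (strat p i)) fun j => by
        by_cases hj : j = i
        · subst hj
          simpa using hσ.1
        · simpa [Function.update_of_ne hj] using hs M ω m' j hM (Sat_others.1 hoth j hj)
    refine (prior hΓ K).PR_zero_possible (ω' := p') ?_ ?_
    · rw [supp_prior]
      simpa using hp'
    · refine (ψ.sat_congr fun j hj => ?_).2 hψ
      change strat p' j = M.strat ω j
      rw [hs', Function.update_of_ne hj]

theorem rationalitySound_and_canonicallyRational (hΓ : Γ.PerfectRecall) (k : ℕ) :
    RationalitySound Γ k ∧ CanonicallyRational hΓ k := by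
  induction k with
  | zero => exact ⟨fun _ _ _ _ _ _ => trivial, fun _ _ _ _ _ => trivial⟩
  | succ k ih => exact ⟨ih.2.sound_succ ih.1, ih.2.succ ih.1⟩

end

theorem mainTheorem7 {n : ℕ} (Γ : ExtGame n) (hΓ : Γ.PerfectRecall) (k : ℕ) :
    (∀ (i : Fin n) (σ : Γ.Strat i),
      List.TFAE [
        σ ∈ Γ.NCD k i,
        ∃ (M : EpStruct Γ) (ω : M.Ω) (m : ℕ), M.Appropriate ∧ M.L1Measurable ∧
          M.RespectsConditioning ∧ M.strat ω i = σ ∧ Sat (Form.RATEFR k i) M ω m,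
        ∃ (M : EpStruct Γ) (ω : M.Ω) (m : ℕ), M.Appropriate ∧
          M.RespectsConditioning ∧ M.strat ω i = σ ∧ Sat (Form.RATEFR k i) M ω m,
        ∃ (M : EpStruct Γ) (ω : M.Ω) (m : ℕ), M.Appropriate ∧ M.L1Measurable ∧
          M.strat ω i = σ ∧ Sat (Form.RATEFR k i) M ω m,
        ∃ (M : EpStruct Γ) (ω : M.Ω) (m : ℕ), M.Appropriate ∧
          M.strat ω i = σ ∧ Sat (Form.RATEFR k i) M ω m]) ∧
    ∃ PR : Fin n → CanonState Γ k → ℕ → LPS (CanonState Γ k × ℕ) ⊤,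
      (canonStruct Γ k PR).Appropriate ∧ (canonStruct Γ k PR).RespectsConditioning ∧
      ∀ (p : CanonState Γ k) (m : ℕ),
        Sat (Form.others p.1.2.1 (Form.RATEFR p.1.1)) (canonStruct Γ k PR) p m := by
  refine ⟨fun i σ => ?_, (CanonState.prior hΓ k).PR, (CanonState.prior hΓ k).appropriate hΓ,
    (CanonState.prior hΓ k).respectsConditioning hΓ rfl, fun p m =>
      (rationalitySound_and_canonicallyRational hΓ p.1.1).2.sat_others m⟩
  obtain ⟨hs, hc⟩ := rationalitySound_and_canonicallyRational hΓ k
  tfae_have 1 → 2 := fun h => hc.exists_sat h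
  tfae_have 2 → 3 := fun ⟨M, ω, m, h1, _, h3⟩ => ⟨M, ω, m, h1, h3⟩
  tfae_have 3 → 5 := fun ⟨M, ω, m, h1, _, h3⟩ => ⟨M, ω, m, h1, h3⟩
  tfae_have 2 → 4 := fun ⟨M, ω, m, h1, h2, _, h3⟩ => ⟨M, ω, m, h1, h2, h3⟩
  tfae_have 4 → 5 := fun ⟨M, ω, m, h1, _, h3⟩ => ⟨M, ω, m, h1, h3⟩
  tfae_have 5 → 1 := by
    rintro ⟨M, ω, m, hM, rfl, h⟩
    exact hs M ω m i hM h
  tfae_finish
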